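/- Let $k,m\in\mathbb N$ and let $\mathbf F^c=(F^c_1,\dots,F^c_m)$ be probability distributions on measurable spaces $\Xi_1,\dots,\Xi_m$ in which points are measurable (for instance subsets of Euclidean spaces). For $i\in[k]$ let $0<T_{ip}<\infty$ be integers and let $h_i:\Xi_1^{T_{i1}}\times\cdots\times\Xi_m^{T_{im}}\to\mathbb R$ be measurable. For an input model $\mathbf F=(F_1,\dots,F_m)$ put $$\eta_i(\mathbf F)=\int h_i(\boldsymbol x_1,\dots,\boldsymbol x_m)\prod_{p=1}^m\prod_{t=1}^{T_{ip}}\mathrm dF_p(\boldsymbol x_{p,t}),$$ and define the influence function of $\eta_i$ at $\mathbf F^c$ by $$\mathrm{IF}_{ip}(x)=\lim_{\epsilon\to0^+}\frac{\eta_i(\mathbf F^{c}_{p,x,\epsilon})-\eta_i(\mathbf F^c)}{\epsilon},$$ where $\mathbf F^{c}_{p,x,\epsilon}$ is $\mathbf F^c$ with $F^c_p$ replaced by $F^c_p+\epsilon(\delta_x-F^c_p)$. Its linearization is $\eta_i^L(\mathbf G)=\eta_i(\mathbf F^c)+\sum_{p=1}^m\int\mathrm{IF}_{ip}\,\mathrm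 dG_p$. Assume: 1. For each $i$, $\int|h_i|^2\prod_{p}\prod_{t}\mathrm dF^c_p<\infty$; moreover, for all $i,p$ and $F^c_p$-almost every $x$, the expectation $\eta_i(\mathbf F^{c}_{p,x,\epsilon})$ in the definition of $\mathrm{IF}_{ip}(x)$ exists (that is, $h_i$ is integrable under $\mathbf F^{c}_{p,x,\epsilon}$) for all sufficiently small $\epsilon>0$. 2. For each $p$ there are $n_p$ i.i.d. observations $X_{p1},\dots,X_{pn_p}$ from $F^c_p$ (the first $n_p$ terms of an i.i.d. sequence), independent across $p$, and, with $n=\frac1m\sum_{p=1}^m n_p\to\infty$ along a sequence of sample-size vectors, $n_p/n\to\beta_p>0$. 3. For each $p$, the covariance matrix of $(\mathrm{IF}_{ip}(X_p))_{i\in[k]}$, $X_p\sim F^c_p$, is positive definite. Let $\alpha\in(0,1)$, let $\chi^2_{k-1,1-\alpha}$ be the $(1-\alpha)$-quantile of the chi-square distribution with $k-1$ degrees of freedom, let $\Delta_s$ be the probability simplex in $\mathbb R^s$, and let $$\mathcal U_\alpha=\Big\{\mathbf w=(\mathbf w_1,\dots,\mathbf w_m):\ \mathbf w_p\in\Delta_{n_p}\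 (p\in[m]),\ -2\sum_{p=1}^m\sum_{j=1}^{n_p}\log(n_pw_{pj})\le\chi^2_{k-1,1-\alpha}\Big\}\qquad(\log0=-\infty),$$ where each $\mathbf w$ is identified with the input model $\big(\sum_{j}w_{pj}\delta_{X_{pj}}\big)_{p\in[m]}$. For $\ell\ne i$ let $$U_{i\ell,n}=\max_{\mathbf w\in\mathcal U_\alpha}\ \big(\eta_i^L(\mathbf w)-\eta_\ell^L(\mathbf w)\big).$$ Then, for every $i\in[k]$, these maxima are attained for all sufficiently large $n$, and $$\liminf_{n\to\infty}\Pr\big\{\eta_i(\mathbf F^c)-\eta_\ell(\mathbf F^c)\le U_{i\ell,n}\ \text{ for all }\ell\ne i\big\}\ \ge\ 1-\alpha.$$ -/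

import Mathlib

open MeasureTheory ProbabilityTheory Filter Topology

noncomputable section

namespace InputUncertainty

/-- The joint law of the inputs of one replication: for each source `p`, `T p` i.i.d. draws from
`F p`, independently over the sources. -/
def inputLaw {m : ℕ} {Ξ : Fin m → Type*} [∀ p, MeasurableSpace (Ξ p)] (T : Fin m → ℕ)
    (F : ∀ p, Measure (Ξ p)) : Measure (∀ p, Fin (T p) → Ξ p) :=
  Measure.pi fun p => Measure.pi fun _ : Fin (T p) => F p

/-- The performance measure `η(F)`: the expected output under the input model `F`. -/
def perf {m : ℕ} {Ξ : Fin m → Type*} [∀ p, MeasurableSpace (Ξ p)] (T : Fin m → ℕ)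
    (h : (∀ p, Fin (T p) → Ξ p) → ℝ) (F : ∀ p, Measure (Ξ p)) : ℝ :=
  ∫ z, h z ∂(inputLaw T F)

/-- The input model `F` with its `p`-th law replaced by `F p + ε (δ_x - F p)`
(meaningful for `0 ≤ ε ≤ 1`). -/
def perturb {m : ℕ} {Ξ : Fin m → Type*} [∀ p, MeasurableSpace (Ξ p)]
    (F : ∀ p, Measure (Ξ p)) (p : Fin m) (x : Ξ p) (ε : ℝ) : ∀ p, Measure (Ξ p) :=
  Function.update F p (ENNReal.ofReal (1 - ε) • F p + ENNReal.ofReal ε • Measure.dirac x)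

/-- The influence function of `η` for source `p` at `F`: the one-sided derivative of `η` at `F` in
the direction `δ_x - F p` of the `p`-th law. -/
def influence {m : ℕ} {Ξ : Fin m → Type*} [∀ p, MeasurableSpace (Ξ p)] (T : Fin m → ℕ)
    (h : (∀ p, Fin (T p) → Ξ p) → ℝ) (F : ∀ p, Measure (Ξ p)) (p : Fin m) (x : Ξ p) : ℝ :=
  limUnder (𝓝[>] (0 : ℝ)) fun ε => (perf T h (perturb F p x ε) - perf T h F) / ε

/-- The linearization `η^L(G; F)` of `η` at `F`, evaluated at `G`. -/
def linearized {m : ℕ} {Ξ : Fin m → Type*} [∀ p, MeasurableSpace (Ξ p)] (T : Fin m → ℕ)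
    (h : (∀ p, Fin (T p) → Ξ p) → ℝ) (G F : ∀ p, Measure (Ξ p)) : ℝ :=
  perf T h F + ∑ p, ∫ x, influence T h F p x ∂(G p)

/-- The reweighted empirical input model: mass `w p j` at the `j`-th observation of source `p`. -/
def reweighted {m : ℕ} {Ξ : Fin m → Type*} [∀ p, MeasurableSpace (Ξ p)] {N : Fin m → ℕ}
    (x : ∀ p, Fin (N p) → Ξ p) (w : ∀ p, Fin (N p) → ℝ) : ∀ p, Measure (Ξ p) :=
  fun p => ∑ j, ENNReal.ofReal (w p j) • Measure.dirac (x p j)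

/-- The chi-square law with `q` degrees of freedom: the law of the sum of the squares of `q`
independent standard normal variables. -/
def chiSquare (q : ℕ) : Measure ℝ :=
  (Measure.pi fun _ : Fin q => gaussianReal 0 1).map fun z => ∑ j, z j ^ 2

/-- The `u`-quantile of the chi-square law with `q` degrees of freedom. -/
def chiSquareQuantile (q : ℕ) (u : ℝ) : ℝ :=
  sInf {x : ℝ | u ≤ (chiSquare q).real (Set.Iic x)}

/-- The ambiguity set of weights for sample sizes `N`, with bound `c` on minus twice the empirical
log-likelihood ratio. Positivity of the weights encodes the convention `log 0 = -∞`. -/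
def ambiguitySet {m : ℕ} (N : Fin m → ℕ) (c : ℝ) : Set (∀ p, Fin (N p) → ℝ) :=
  {w | (∀ p, w p ∈ stdSimplex ℝ (Fin (N p))) ∧ (∀ p j, 0 < w p j) ∧
    -2 * ∑ p, ∑ j, Real.log ((N p : ℝ) * w p j) ≤ c}

/-- The values over the ambiguity set, built from the data `x`, of the linearized difference
between the performance measures `(T₁, h₁)` and `(T₂, h₂)`. -/
def gapValues {m : ℕ} {Ξ : Fin m → Type*} [∀ p, MeasurableSpace (Ξ p)]
    (T₁ T₂ : Fin m → ℕ) (h₁ : (∀ p, Fin (T₁ p) → Ξ p) → ℝ) (h₂ : (∀ p, Fin (T₂ p) → Ξ p) → ℝ)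
    (F : ∀ p, Measure (Ξ p)) {N : Fin m → ℕ} (x : ∀ p, Fin (N p) → Ξ p) (c : ℝ) : Set ℝ :=
  (fun w => linearized T₁ h₁ (reweighted x w) F - linearized T₂ h₂ (reweighted x w) F) ''
    ambiguitySet N c

/-- The optimal value of the worst-case linearized pairwise-difference program. -/
def worstCaseGap {m : ℕ} {Ξ : Fin m → Type*} [∀ p, MeasurableSpace (Ξ p)]
    (T₁ T₂ : Fin m → ℕ) (h₁ : (∀ p, Fin (T₁ p) → Ξ p) → ℝ) (h₂ : (∀ p, Fin (T₂ p) → Ξ p) → ℝ)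
    (F : ∀ p, Measure (Ξ p)) {N : Fin m → ℕ} (x : ∀ p, Fin (N p) → Ξ p) (c : ℝ) : ℝ :=
  sSup (gapValues T₁ T₂ h₁ h₂ F x c)

/-- The average sample size over the `m` sources. -/
def avgSize {m : ℕ} (N : Fin m → ℕ) : ℝ := (1 / (m : ℝ)) * ∑ p, (N p : ℝ)

end InputUncertainty

end

/-! Only a lower bound on the worst case is needed, so one explicit admissible reweighting replaces
empirical-likelihood duality. Fix `i`, write `D l` for the difference of the influence functions of
`i` and `l`, and let `A` be the average sample size. Each `D l` has mean zero and finite positive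
variance under every source (`integrable_influence`, `memLp_two_of_posDef_cov`,
`integral_sub_sq_pos_of_posDef_cov`). On the ambiguity set the linearized difference equals the true
difference plus the weighted sums of `D l`, so it suffices to find weights making these sums
nonnegative.

Tilt the empirical weights of source `p` by the factor `1 + τ (y - mean)` with `τ = lam √A / N p`.
By the strong law the likelihood cost tends to at most `lam² σ²`, up to a factor near 1, and the
scaled gain tends to `lam σ²`, where `σ²` is the limiting variance of the `√A`-scaled sum of sample
means. Taking `lam` just below `√c / σ` makes the tilt admissible with gain at least `(1 - d) √c σ`
(`eventually_mem_tiltSet`). Coverage can then fail only if some scaled sum is at most `-(1 - d) √c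
σ` (`perf_sub_le_worstCaseGap`).

The scaled sums for all `l ≠ i` are jointly asymptotically Gaussian in dimension `k - 1`. The limit
is the image of a standard vector, and by Cauchy–Schwarz the whole ball of radius `(1 - d) √c` lands
in the required orthant (`chiSquare_le_multivariateGaussian`). This one ball serves all `l` at once,
whence `k - 1` degrees of freedom and no union-bound correction of the level. Letting `d` tend to 0
gives `1 - α`. -/

namespace InputUncertainty

/-! ### Product measures with one factor changed. -/

section Product

variable {ι : Type*} [Fintype ι] [DecidableEq ι] {α : ι → Type*} [∀ i, MeasurableSpace (α i)]

lemma pi_update_apply_rect (μ : ∀ i, Measure (α i)) [∀ i, IsProbabilityMeasure (μ i)] (i : ι)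
    (ν : Measure (α i)) [IsFiniteMeasure ν] (s : ∀ i, Set (α i)) :
    Measure.pi (Function.update μ i ν) (Set.univ.pi s) =
      ν (s i) * ∏ j ∈ Finset.univ.erase i, μ j (s j) := by
  have : ∀ j, IsFiniteMeasure (Function.update μ i ν j) := by
    intro j
    by_cases hj : j = i
    · subst hj; simpa using ‹IsFiniteMeasure ν›
    · rw [Function.update_of_ne hj]; infer_instance
  rw [Measure.pi_pi, ← Finset.mul_prod_erase _ _ (Finset.mem_univ i), Function.update_self]
  congr 1
  refine Finset.prod_congr rfl fun j hj => ?_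
  rw [Function.update_of_ne (Finset.ne_of_mem_erase hj)]

lemma pi_update_sum {σ : Type*} (μ : ∀ i, Measure (α i)) [∀ i, IsProbabilityMeasure (μ i)] (i : ι)
    (A : Finset σ) (c : σ → ENNReal) (ν : σ → Measure (α i)) [∀ a, IsFiniteMeasure (ν a)]
    (hc : ∀ a, c a ≠ ⊤) :
    Measure.pi (Function.update μ i (∑ a ∈ A, c a • ν a)) =
      ∑ a ∈ A, c a • Measure.pi (Function.update μ i (ν a)) := by
  have hf : IsFiniteMeasure (∑ a ∈ A, c a • ν a) := by
    have : ∀ a, IsFiniteMeasure (c a • ν a) := fun a => Measure.smul_finite _ (hc a)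
    infer_instance
  have : ∀ j, IsFiniteMeasure (Function.update μ i (∑ a ∈ A, c a • ν a) j) := by
    intro j
    by_cases hj : j = i
    · subst hj; simpa using hf
    · rw [Function.update_of_ne hj]; infer_instance
  refine Measure.pi_eq fun s _ => ?_
  rw [← Measure.pi_pi, pi_update_apply_rect]
  simp only [Measure.coe_finsetSum, Finset.sum_apply, Measure.smul_apply, smul_eq_mul,
    pi_update_apply_rect, Finset.sum_mul, mul_assoc]

/-- Replacing one coordinate by a function of itself and of an independent variable. -/
lemma map_update_prod_pi {κ : Type*} [MeasurableSpace κ] (ρ : Measure κ) [IsProbabilityMeasure ρ]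
    (μ : ∀ i, Measure (α i)) [∀ i, IsProbabilityMeasure (μ i)] (i : ι) (g : κ × α i → α i)
    (hg : Measurable g) :
    (ρ.prod (Measure.pi μ)).map (fun y => Function.update y.2 i (g (y.1, y.2 i))) =
      Measure.pi (Function.update μ i ((ρ.prod (μ i)).map g)) := by
  have hp : IsProbabilityMeasure ((ρ.prod (μ i)).map g) :=
    Measure.isProbabilityMeasure_map hg.aemeasurable
  have : ∀ j, IsFiniteMeasure (Function.update μ i ((ρ.prod (μ i)).map g) j) := by
    intro j
    by_cases hj : j = i
    · subst hj; simp only [Function.update_self]; infer_instance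
    · rw [Function.update_of_ne hj]; infer_instance
  have hm : Measurable fun y : κ × (∀ i, α i) => Function.update y.2 i (g (y.1, y.2 i)) := by
    refine measurable_pi_lambda _ fun j => ?_
    by_cases hj : j = i
    · subst hj; simp only [Function.update_self]; fun_prop
    · simp only [Function.update_of_ne hj]; fun_prop
  refine (Measure.pi_eq fun s hs => ?_).symm
  have hpre : MeasurableSet (Set.univ.pi s) := MeasurableSet.univ_pi hs
  rw [← Measure.pi_pi, pi_update_apply_rect, Measure.map_apply hm hpre,
    Measure.prod_apply (hm hpre), Measure.map_apply hg (hs i), Measure.prod_apply (hg (hs i)),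
    ← lintegral_mul_const _ (measurable_measure_prodMk_left (hg (hs i)))]
  refine lintegral_congr fun x => ?_
  have : (Prod.mk x ⁻¹' ((fun y : κ × (∀ i, α i) =>
      Function.update y.2 i (g (y.1, y.2 i))) ⁻¹' Set.univ.pi s)) =
      Set.univ.pi (Function.update s i (Prod.mk x ⁻¹' (g ⁻¹' s i))) := by
    ext z
    simp only [Set.mem_preimage, Set.mem_univ_pi]
    refine forall_congr' fun j => ?_
    by_cases hj : j = i
    · subst hj; simp
    · simp [Function.update_of_ne hj]
  rw [this, Measure.pi_pi, ← Finset.mul_prod_erase _ _ (Finset.mem_univ i), Function.update_self]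
  congr 1
  refine Finset.prod_congr rfl fun j hj => ?_
  rw [Function.update_of_ne (Finset.ne_of_mem_erase hj)]

end Product

/-- The product measure is multilinear in its factors, so a product of mixtures expands over the set
of coordinates that take the first component. -/
lemma pi_add_smul {τ E : Type*} [Fintype τ] [DecidableEq τ] [MeasurableSpace E]
    (μ ν : Measure E) [IsProbabilityMeasure μ] [IsProbabilityMeasure ν] (a b : ENNReal)
    (ha : a ≠ ⊤) (hb : b ≠ ⊤) :
    Measure.pi (fun _ : τ => a • μ + b • ν) =
      ∑ S : Finset τ, (a ^ S.card * b ^ Sᶜ.card) •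
        Measure.pi (fun t => if t ∈ S then μ else ν) := by
  have h1 : IsFiniteMeasure (a • μ) := Measure.smul_finite _ ha
  have h2 : IsFiniteMeasure (b • ν) := Measure.smul_finite _ hb
  have h3 : ∀ (S : Finset τ) (t : τ), IsProbabilityMeasure (if t ∈ S then μ else ν) := by
    intro S t; split_ifs <;> infer_instance
  refine Measure.pi_eq fun s _ => ?_
  simp only [Measure.coe_finsetSum, Finset.sum_apply, smul_eq_mul,
    Measure.coe_add, Pi.add_apply, Measure.pi_pi, Finset.prod_add, Finset.powerset_univ,
    Measure.coe_smul, Pi.smul_apply]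
  refine Finset.sum_congr rfl fun S _ => ?_
  rw [← Finset.prod_mul_prod_compl S (fun i => (if i ∈ S then μ else ν) (s i)),
    Finset.prod_mul_distrib, Finset.prod_mul_distrib, Finset.prod_const, Finset.prod_const,
    ← Finset.compl_eq_univ_sdiff, mul_mul_mul_comm]
  congr 2
  · exact Finset.prod_congr rfl fun i hi => by rw [if_pos hi]
  · exact Finset.prod_congr rfl fun i hi => by rw [if_neg (Finset.mem_compl.1 hi)]

/-! ### Influence functions: explicit formula, integrability and mean zero. -/

variable {m : ℕ} {Ξ : Fin m → Type*} [∀ p, MeasurableSpace (Ξ p)]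

/-- The law of the inputs when the draws of source `p` outside `S` are fixed at `x`. -/
noncomputable def frozenLaw (T : Fin m → ℕ) (F : ∀ p, Measure (Ξ p)) (p : Fin m)
    (S : Finset (Fin (T p))) (x : Ξ p) : Measure (∀ p, Fin (T p) → Ξ p) :=
  Measure.pi (Function.update (fun q => Measure.pi fun _ : Fin (T q) => F q) p
    (Measure.pi fun t => if t ∈ S then F p else Measure.dirac x))

variable (T : Fin m → ℕ) (F : ∀ p, Measure (Ξ p)) (p : Fin m)

lemma frozenLaw_univ (x : Ξ p) : frozenLaw T F p Finset.univ x = inputLaw T F := by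
  simp [frozenLaw, inputLaw]

variable [∀ p, IsProbabilityMeasure (F p)]

lemma inputLaw_perturb {ε : ℝ} (x : Ξ p) :
    inputLaw T (perturb F p x ε) = ∑ S : Finset (Fin (T p)),
      (ENNReal.ofReal (1 - ε) ^ S.card * ENNReal.ofReal ε ^ Sᶜ.card) • frozenLaw T F p S x := by
  have h3 : ∀ (S : Finset (Fin (T p))) t,
      IsProbabilityMeasure (if t ∈ S then F p else Measure.dirac x) := by
    intro S t; split_ifs <;> infer_instance
  unfold frozenLaw
  rw [← pi_update_sum _ _ _ _ _
    (fun S => ENNReal.mul_ne_top (by finiteness) (by finiteness)),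
    ← pi_add_smul _ _ _ _ ENNReal.ofReal_ne_top ENNReal.ofReal_ne_top, inputLaw, perturb]
  congr 1
  funext q
  by_cases hq : q = p
  · subst hq; simp
  · simp [Function.update_of_ne hq]

/-- Overwriting the `t`-th draw of source `p`. -/
def overwrite (t : Fin (T p)) (y : Ξ p × (∀ p, Fin (T p) → Ξ p)) : ∀ p, Fin (T p) → Ξ p :=
  Function.update y.2 p (Function.update (y.2 p) t y.1)

lemma measurable_overwrite (t : Fin (T p)) : Measurable (overwrite (Ξ := Ξ) T p t) := by
  refine measurable_pi_lambda _ fun q => ?_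
  unfold overwrite
  by_cases hq : q = p
  · subst hq
    simp only [Function.update_self]
    refine measurable_pi_lambda _ fun s => ?_
    by_cases hs : s = t
    · subst hs; simp only [Function.update_self]; fun_prop
    · simp only [Function.update_of_ne hs]; fun_prop
  · simp only [Function.update_of_ne hq]; fun_prop

/-- Two choices of `ρ` matter: `ρ = F p` leaves the input law unchanged, and `ρ = dirac x` freezes
the draw `t` at `x`. Together they reduce averaging over the frozen value to Fubini. -/
lemma map_overwrite (t : Fin (T p)) (ρ : Measure (Ξ p)) [IsProbabilityMeasure ρ] :
    (ρ.prod (inputLaw T F)).map (overwrite T p t) =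
      Measure.pi (Function.update (fun q => Measure.pi fun _ : Fin (T q) => F q) p
        (Measure.pi (Function.update (fun _ => F p) t ρ))) := by
  have h1 := map_update_prod_pi ρ (fun _ : Fin (T p) => F p) t Prod.fst measurable_fst
  rw [Measure.map_fst_prod, measure_univ, one_smul] at h1
  rw [← h1]
  refine map_update_prod_pi ρ (fun q => Measure.pi fun _ : Fin (T q) => F q) p
    (fun y => Function.update y.2 t y.1) ?_
  refine measurable_pi_lambda _ fun s => ?_
  by_cases hs : s = t
  · subst hs; simp only [Function.update_self]; fun_prop
  · simp only [Function.update_of_ne hs]; fun_prop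

lemma map_overwrite_self (t : Fin (T p)) :
    ((F p).prod (inputLaw T F)).map (overwrite T p t) = inputLaw T F := by
  rw [map_overwrite, Function.update_eq_self_iff.2 rfl, Function.update_eq_self_iff.2 rfl]
  rfl

lemma frozenLaw_compl_singleton (t : Fin (T p)) (x : Ξ p) :
    frozenLaw T F p {t}ᶜ x = (inputLaw T F).map (overwrite T p t ∘ Prod.mk x) := by
  have := map_overwrite T F p t (Measure.dirac x)
  have hi : IsProbabilityMeasure (inputLaw T F) := by unfold inputLaw; infer_instance
  rw [Measure.dirac_prod, Measure.map_map (measurable_overwrite T p t) measurable_prodMk_left]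
    at this
  rw [this, frozenLaw]
  congr 2
  congr 1
  funext s
  by_cases hs : s = t
  · subst hs; simp
  · simp [hs]

variable {T F p} {h : (∀ p, Fin (T p) → Ξ p) → ℝ}

lemma integrable_integral_frozenLaw_compl_singleton (hm : Measurable h)
    (hi : Integrable h (inputLaw T F)) (t : Fin (T p)) :
    Integrable (fun x => ∫ z, h z ∂frozenLaw T F p {t}ᶜ x) (F p) ∧
      ∫ x, ∫ z, h z ∂frozenLaw T F p {t}ᶜ x ∂F p = perf T h F := by
  have hP : IsProbabilityMeasure (inputLaw T F) := by unfold inputLaw; infer_instance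
  have e : ∀ x, ∫ z, h z ∂frozenLaw T F p {t}ᶜ x =
      ∫ z, (h ∘ overwrite T p t) (x, z) ∂inputLaw T F := by
    intro x
    rw [frozenLaw_compl_singleton, integral_map
      ((measurable_overwrite T p t).comp measurable_prodMk_left).aemeasurable
      hm.aestronglyMeasurable]
    rfl
  have hi' : Integrable (h ∘ overwrite T p t) ((F p).prod (inputLaw T F)) := by
    rw [← integrable_map_measure (by rw [map_overwrite_self]; exact hi.1)
      (measurable_overwrite T p t).aemeasurable, map_overwrite_self]
    exact hi
  simp_rw [e]
  refine ⟨hi'.integral_prod_left, ?_⟩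
  rw [← integral_prod _ hi', perf]
  conv_rhs => rw [← map_overwrite_self T F p t]
  rw [integral_map (measurable_overwrite T p t).aemeasurable hm.aestronglyMeasurable]
  rfl

lemma perf_perturb {ε : ℝ} (hε : 0 < ε) (hε1 : ε < 1) (x : Ξ p)
    (hi : Integrable h (inputLaw T (perturb F p x ε))) :
    perf T h (perturb F p x ε) = ∑ S : Finset (Fin (T p)),
      ((1 - ε) ^ S.card * ε ^ Sᶜ.card) * ∫ z, h z ∂frozenLaw T F p S x := by
  rw [inputLaw_perturb, integrable_finsetSum_measure] at hi
  rw [perf, inputLaw_perturb, integral_finsetSum_measure hi]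
  refine Finset.sum_congr rfl fun S _ => ?_
  rw [integral_smul_measure, smul_eq_mul, ENNReal.toReal_mul, ENNReal.toReal_pow,
    ENNReal.toReal_pow, ENNReal.toReal_ofReal (by linarith), ENNReal.toReal_ofReal hε.le]

/-- The derivative at `0` of `ε ↦ (1 - ε) ^ a * ε ^ b`. -/
noncomputable def mixDeriv (a b : ℕ) : ℝ := -(a * (0 : ℝ) ^ b) + b * (0 : ℝ) ^ (b - 1)

lemma hasDerivAt_mix (a b : ℕ) :
    HasDerivAt (fun ε : ℝ => (1 - ε) ^ a * ε ^ b) (mixDeriv a b) 0 := by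
  have h1 : HasDerivAt (fun ε : ℝ => (1 - ε) ^ a) (a * (1 - 0) ^ (a - 1) * (-1)) 0 :=
    ((hasDerivAt_id (0 : ℝ)).const_sub 1).fun_pow a
  have h2 : HasDerivAt (fun ε : ℝ => ε ^ b) (b * 0 ^ (b - 1)) 0 := hasDerivAt_pow b 0
  refine (h1.fun_mul h2).congr_deriv ?_
  simp [mixDeriv]

/-- The mixing weights sum to `((1 - ε) + ε) ^ card τ = 1` for every `ε`, so their derivatives
cancel. -/
lemma sum_mixDeriv (τ : Type*) [Fintype τ] [DecidableEq τ] :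
    ∑ S : Finset τ, mixDeriv S.card Sᶜ.card = 0 := by
  have h1 : HasDerivAt (fun ε : ℝ => ∑ S : Finset τ, (1 - ε) ^ S.card * ε ^ Sᶜ.card)
      (∑ S : Finset τ, mixDeriv S.card Sᶜ.card) 0 :=
    HasDerivAt.fun_sum fun S _ => hasDerivAt_mix _ _
  have h2 : (fun ε : ℝ => ∑ S : Finset τ, (1 - ε) ^ S.card * ε ^ Sᶜ.card) = fun _ => 1 := by
    funext ε
    have := Finset.prod_add (fun _ : τ => 1 - ε) (fun _ => ε) Finset.univ
    simp only [sub_add_cancel, Finset.prod_const_one, Finset.powerset_univ, Finset.prod_const,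
      ← Finset.compl_eq_univ_sdiff] at this
    exact this.symm
  rw [h2] at h1
  exact h1.unique (hasDerivAt_const _ _)

/-- For small `ε > 0` the perturbed performance is a polynomial in `ε`, with the frozen expectations
as constants; the one-sided limit is the derivative of that polynomial at 0. -/
lemma influence_eq {x : Ξ p} (hx : ∀ᶠ ε in 𝓝[>] (0 : ℝ),
      Integrable h (inputLaw T (perturb F p x ε))) :
    influence T h F p x = ∑ S : Finset (Fin (T p)),
      mixDeriv S.card Sᶜ.card * ∫ z, h z ∂frozenLaw T F p S x := by
  have h1 : HasDerivAt (fun ε : ℝ => ∑ S : Finset (Fin (T p)),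
      ((1 - ε) ^ S.card * ε ^ Sᶜ.card) * ∫ z, h z ∂frozenLaw T F p S x)
      (∑ S : Finset (Fin (T p)), mixDeriv S.card Sᶜ.card * ∫ z, h z ∂frozenLaw T F p S x) 0 :=
    HasDerivAt.fun_sum fun S _ => (hasDerivAt_mix _ _).mul_const _
  have h0 : ∑ S : Finset (Fin (T p)),
      ((1 - (0 : ℝ)) ^ S.card * 0 ^ Sᶜ.card) * ∫ z, h z ∂frozenLaw T F p S x = perf T h F := by
    rw [Finset.sum_eq_single Finset.univ]
    · simp [frozenLaw_univ, perf]
    · intro S _ hS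
      have : Sᶜ.card ≠ 0 := by
        rw [Finset.card_ne_zero, Finset.nonempty_iff_ne_empty]
        simpa [Finset.compl_eq_empty_iff] using hS
      simp [zero_pow this]
    · simp
  have h2 := (hasDerivAt_iff_tendsto_slope.1 h1).mono_left
    (nhdsWithin_mono (0 : ℝ) (fun y (hy : 0 < y) => hy.ne' : Set.Ioi (0 : ℝ) ⊆ {0}ᶜ))
  refine Tendsto.limUnder_eq (h2.congr' ?_)
  filter_upwards [hx, Ioo_mem_nhdsGT (zero_lt_one' ℝ)] with ε hi hε
  rw [slope_def_field, h0, perf_perturb hε.1 hε.2 x hi, sub_zero]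

lemma integrable_influence (hm : Measurable h) (hi : Integrable h (inputLaw T F))
    (hx : ∀ᵐ x ∂F p, ∀ᶠ ε in 𝓝[>] (0 : ℝ), Integrable h (inputLaw T (perturb F p x ε))) :
    Integrable (influence T h F p) (F p) ∧ ∫ x, influence T h F p x ∂F p = 0 := by
  have key : ∀ S : Finset (Fin (T p)),
      Integrable (fun x => mixDeriv S.card Sᶜ.card * ∫ z, h z ∂frozenLaw T F p S x) (F p) ∧
      ∫ x, mixDeriv S.card Sᶜ.card * ∫ z, h z ∂frozenLaw T F p S x ∂F p =
        mixDeriv S.card Sᶜ.card * perf T h F := by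
    intro S
    rw [integral_const_mul]
    -- No frozen draw gives a constant, one frozen draw is handled by Fubini. Two or more contribute
    -- only at order `ε²`; their coefficient is zero, so nothing is asked of the frozen expectation,
    -- whose integrability in `x` is not available.
    rcases Nat.lt_trichotomy Sᶜ.card 1 with h0 | h0 | h0
    · have : S = Finset.univ := by
        rw [← Finset.compl_eq_empty_iff, ← Finset.card_eq_zero]; omega
      subst this
      simp only [frozenLaw_univ]
      exact ⟨integrable_const _, by simp [perf]⟩
    · obtain ⟨t, ht⟩ := Finset.card_eq_one.1 h0
      obtain rfl : S = {t}ᶜ := by rw [← ht, compl_compl]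
      have := integrable_integral_frozenLaw_compl_singleton (p := p) hm hi t
      exact ⟨this.1.const_mul _, by rw [this.2]⟩
    · have : mixDeriv S.card Sᶜ.card = 0 := by
        simp [mixDeriv, zero_pow (show Sᶜ.card ≠ 0 by omega),
          zero_pow (show Sᶜ.card - 1 ≠ 0 by omega)]
      rw [this]
      simp
  have e : influence T h F p =ᵐ[F p] fun x => ∑ S : Finset (Fin (T p)),
      mixDeriv S.card Sᶜ.card * ∫ z, h z ∂frozenLaw T F p S x := by
    filter_upwards [hx] with x hx using influence_eq hx
  rw [integrable_congr e, integral_congr_ae e]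
  refine ⟨integrable_finsetSum _ fun S _ => (key S).1, ?_⟩
  rw [integral_finsetSum _ fun S _ => (key S).1]
  simp_rw [fun S => (key S).2]
  -- Every term integrates to its coefficient times the same number `perf T h F`.
  rw [← Finset.sum_mul, sum_mixDeriv, zero_mul]

/-! ### Central limit theorem for several sources with different sample sizes. -/

section CentralLimit

/-- Since `N g` converges, `g → 0` and `N (log (1 + g) - g) = O(N g²) → 0`; exponentiate. -/
lemma tendsto_one_add_pow_exp {N : ℕ → ℕ} {g : ℕ → ℂ} {t : ℂ} (hN : Tendsto N atTop atTop)
    (hg : Tendsto (fun r => N r * g r) atTop (𝓝 t)) :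
    Tendsto (fun r => (1 + g r) ^ N r) atTop (𝓝 (Complex.exp t)) := by
  have hinv : Tendsto (fun r => ((N r : ℂ))⁻¹) atTop (𝓝 0) :=
    (tendsto_inv_atTop_nhds_zero_nat (𝕜 := ℂ)).comp hN
  have hg0 : Tendsto g atTop (𝓝 0) := by
    have := hg.mul hinv
    rw [mul_zero] at this
    refine this.congr' ?_
    filter_upwards [hN.eventually_ne_atTop 0] with r hr
    have : (N r : ℂ) ≠ 0 := by exact_mod_cast hr
    field_simp
  have hO := (Complex.log_sub_self_isBigO.comp_tendsto hg0)
  have h1 : (fun r => (N r : ℂ) * (Complex.log (1 + g r) - g r)) =O[atTop]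
      fun r => (N r : ℂ) * g r ^ 2 := (Asymptotics.isBigO_refl _ _).mul hO
  have h2 : Tendsto (fun r => (N r : ℂ) * g r ^ 2) atTop (𝓝 0) := by
    have := hg.mul hg0
    rw [mul_zero] at this
    exact this.congr fun r => by ring
  have h3 : Tendsto (fun r => (N r : ℂ) * Complex.log (1 + g r)) atTop (𝓝 t) := by
    have := hg.add (h1.trans_tendsto h2)
    rw [add_zero] at this
    exact this.congr fun r => by ring
  refine ((Complex.continuous_exp.tendsto t).comp h3).congr' ?_
  filter_upwards [hg0.eventually_ne (show (0 : ℂ) ≠ -1 by simp)] with r hr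
  have : 1 + g r ≠ 0 := fun h0 => hr (by linear_combination h0)
  simp only [Function.comp_apply]
  rw [Complex.exp_nat_mul, Complex.exp_log this]

lemma charFun_map_const_smul {Ω : Type*} [MeasurableSpace Ω] {P : Measure Ω} {E : Type*}
    [NormedAddCommGroup E] [InnerProductSpace ℝ E] [MeasurableSpace E] [BorelSpace E]
    [SecondCountableTopology E] {Y : Ω → E} (hY : AEMeasurable Y P) (a : ℝ) (t : E) :
    charFun (P.map fun ω => a • Y ω) t = charFun (P.map fun ω => inner ℝ (Y ω) t) a := by
  have h2 : AEMeasurable (fun ω => inner ℝ (Y ω) t) P :=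
    (by fun_prop : Measurable fun y : E => inner ℝ y t).comp_aemeasurable hY
  have h3 : AEMeasurable (fun ω => a • Y ω) P := hY.const_smul a
  rw [charFun_apply, charFun_apply, integral_map h3 (by fun_prop),
    integral_map h2 (by fun_prop)]
  refine integral_congr_ae (ae_of_all _ fun ω => ?_)
  simp [real_inner_smul_left, mul_comm]

variable {Ω : Type*} [MeasurableSpace Ω] {P : Measure Ω} [IsProbabilityMeasure P]

/-- The second-order Taylor expansion of the characteristic function at 0 gives `N (φ(a) - 1) → -γ
E[Z²] / 2`. -/
lemma tendsto_charFun_pow {Z : Ω → ℝ} (hZ : MemLp Z 2 P) (h0 : ∫ ω, Z ω ∂P = 0)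
    {N : ℕ → ℕ} {a : ℕ → ℝ} {γ : ℝ} (hN : Tendsto N atTop atTop)
    (ha : Tendsto (fun r => (N r : ℝ) * a r ^ 2) atTop (𝓝 γ)) :
    Tendsto (fun r => charFun (P.map Z) (a r) ^ N r) atTop
      (𝓝 (Complex.exp ((-(γ * ∫ ω, Z ω ^ 2 ∂P) / 2 : ℝ)))) := by
  set v := ∫ ω, Z ω ^ 2 ∂P with hv
  have hm : AEMeasurable Z P := hZ.1.aemeasurable
  have : IsProbabilityMeasure (P.map Z) := Measure.isProbabilityMeasure_map hm
  have hid : MemLp id 2 (P.map Z) := (memLp_map_measure_iff (by fun_prop) hm).2 hZ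
  have hT : (fun t : ℝ => charFun (P.map Z) t - (1 - v * t ^ 2 / 2)) =o[𝓝 0]
      fun t : ℝ => t ^ 2 := by
    have e : ∀ t : ℝ, taylorWithinEval (charFun (P.map Z)) 2 Set.univ 0 t =
        1 - (v : ℂ) * t ^ 2 / 2 := by
      intro t
      rw [taylorWithinEval_charFun_two_zero hm hid, h0]
      simp [hv]
    simp_rw [← e]
    convert! taylor_isLittleO_univ ?_
    · simp
    · exact contDiff_charFun hid
  have ha2 : Tendsto (fun r => a r ^ 2) atTop (𝓝 0) := by
    have := ha.mul (tendsto_inv_atTop_nhds_zero_nat (𝕜 := ℝ) |>.comp hN)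
    rw [mul_zero] at this
    refine this.congr' ?_
    filter_upwards [hN.eventually_ne_atTop 0] with r hr
    have : (N r : ℝ) ≠ 0 := by exact_mod_cast hr
    simp only [Function.comp_apply]
    field_simp
  have ha0 : Tendsto a atTop (𝓝 0) := by
    have := ha2.sqrt
    simp only [Real.sqrt_sq_eq_abs, Real.sqrt_zero] at this
    exact (tendsto_zero_iff_abs_tendsto_zero _).2 this
  have hO := hT.comp_tendsto ha0
  have h1 : (fun r => (N r : ℂ) * (charFun (P.map Z) (a r) - (1 - v * (a r : ℂ) ^ 2 / 2)))
      =o[atTop] fun r => (N r : ℝ) * a r ^ 2 := by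
    refine Asymptotics.IsBigO.mul_isLittleO ?_ hO
    exact Asymptotics.IsBigO.of_bound 1 (Eventually.of_forall fun r => by simp)
  have h2 : Tendsto (fun r => (N r : ℂ) *
      (charFun (P.map Z) (a r) - (1 - v * (a r : ℂ) ^ 2 / 2))) atTop (𝓝 0) := by
    have := h1.trans_isBigO (ha.isBigO_one ℝ)
    rwa [Asymptotics.isLittleO_one_iff] at this
  have h3 : Tendsto (fun r => (N r : ℂ) * (charFun (P.map Z) (a r) - 1)) atTop
      (𝓝 ((-(γ * v) / 2 : ℝ) : ℂ)) := by
    have h4 : Tendsto (fun r => (((N r : ℝ) * a r ^ 2 * (-v / 2) : ℝ) : ℂ)) atTop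
        (𝓝 ((γ * (-v / 2) : ℝ) : ℂ)) :=
      (Complex.continuous_ofReal.tendsto _).comp (ha.mul_const _)
    have := h2.add h4
    rw [zero_add] at this
    convert this using 2 with r
    · push_cast; ring
    · push_cast; ring
  simpa using tendsto_one_add_pow_exp hN h3

variable {E : Type*} [NormedAddCommGroup E] [InnerProductSpace ℝ E] [MeasurableSpace E]
  [BorelSpace E] [SecondCountableTopology E]

lemma tendsto_charFun_weighted_sum {ι : Type*} [Fintype ι] {Y : ι → ℕ → Ω → E}
    (hY : ∀ p j, AEMeasurable (Y p j) P) (hident : ∀ p j, P.map (Y p j) = P.map (Y p 0))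
    (hindep : iIndepFun (fun a : (_ : ι) × ℕ => Y a.1 a.2) P) (t : E)
    (hL2 : ∀ p, MemLp (fun ω => inner ℝ (Y p 0 ω) t) 2 P)
    (h0 : ∀ p, ∫ ω, inner ℝ (Y p 0 ω) t ∂P = 0)
    {N : ℕ → ι → ℕ} {a : ℕ → ι → ℝ} {γ : ι → ℝ} (hN : ∀ p, Tendsto (fun r => N r p) atTop atTop)
    (ha : ∀ p, Tendsto (fun r => (N r p : ℝ) * a r p ^ 2) atTop (𝓝 (γ p))) :
    Tendsto (fun r => charFun (P.map fun ω => ∑ p, ∑ j : Fin (N r p), a r p • Y p j ω) t) atTop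
      (𝓝 (Complex.exp ((-(∑ p, γ p * ∫ ω, inner ℝ (Y p 0 ω) t ^ 2 ∂P) / 2 : ℝ)))) := by
  have key : ∀ r, charFun (P.map fun ω => ∑ p, ∑ j : Fin (N r p), a r p • Y p j ω) t =
      ∏ p, charFun (P.map fun ω => inner ℝ (Y p 0 ω) t) (a r p) ^ N r p := by
    intro r
    have e : (fun ω => ∑ p, ∑ j : Fin (N r p), a r p • Y p j ω) =
        fun ω => ∑ b : (p : ι) × Fin (N r p), a r b.1 • Y b.1 b.2 ω := by
      funext ω
      rw [Fintype.sum_sigma]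
    have hinj : Function.Injective
        (fun b : (p : ι) × Fin (N r p) => (⟨b.1, b.2⟩ : (_ : ι) × ℕ)) := by
      rintro ⟨p, j⟩ ⟨p', j'⟩ h
      simp only [Sigma.mk.injEq] at h
      obtain ⟨rfl, h⟩ := h
      simp only [heq_eq_eq] at h
      rw [Fin.ext h]
    have hi := (hindep.precomp hinj).comp (fun b y => a r b.1 • y)
      (fun b => measurable_const_smul _)
    rw [e]
    have : charFun (P.map fun ω => ∑ b : (p : ι) × Fin (N r p), a r b.1 • Y b.1 b.2 ω) =
        ∏ b : (p : ι) × Fin (N r p), charFun (P.map fun ω => a r b.1 • Y b.1 b.2 ω) :=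
      hi.charFun_map_fun_sum_eq_prod (fun b : (p : ι) × Fin (N r p) =>
        (hY b.1 b.2).const_smul (a r b.1))
    rw [this, Finset.prod_apply, Fintype.prod_sigma]
    refine Finset.prod_congr rfl fun p _ => ?_
    rw [Finset.prod_congr rfl fun j _ => ?_, Finset.prod_const, Finset.card_univ, Fintype.card_fin]
    rw [← charFun_map_const_smul (hY p 0), charFun_map_smul_comp (hY p j), hident,
      ← charFun_map_smul_comp (hY p 0)]
  simp_rw [key]
  have hlim : Complex.exp ((-(∑ p, γ p * ∫ ω, inner ℝ (Y p 0 ω) t ^ 2 ∂P) / 2 : ℝ)) =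
      ∏ p, Complex.exp ((-(γ p * ∫ ω, inner ℝ (Y p 0 ω) t ^ 2 ∂P) / 2 : ℝ)) := by
    rw [← Complex.exp_sum, ← Complex.ofReal_sum]
    congr 2
    rw [← Finset.sum_div, Finset.sum_neg_distrib]
  rw [hlim]
  exact tendsto_finsetProd _ fun p _ => tendsto_charFun_pow (hL2 p) (h0 p) (hN p) (ha p)

end CentralLimit

/-! ### Chi-square quantiles and Gaussian orthants. -/

section ChiSquare

instance (q : ℕ) : IsProbabilityMeasure (chiSquare q) :=
  Measure.isProbabilityMeasure_map (Measurable.aemeasurable (by fun_prop))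

lemma chiSquare_Iio_zero (q : ℕ) : chiSquare q (Set.Iio 0) = 0 := by
  rw [chiSquare, Measure.map_apply (by fun_prop) measurableSet_Iio]
  convert measure_empty (μ := Measure.pi fun _ : Fin q => gaussianReal 0 1)
  ext z
  simpa using Finset.sum_nonneg fun j _ => sq_nonneg (z j)

/-- Once the other coordinates are fixed, the first one is confined to at most two points, a null
set for the Gaussian. -/
lemma chiSquare_singleton (q : ℕ) (c : ℝ) : chiSquare (q + 1) {c} = 0 := by
  rw [chiSquare, Measure.map_apply (by fun_prop) (measurableSet_singleton c)]
  have hg : NullSingletonClass (gaussianReal 0 1) := nullSingletonClass_gaussianReal one_ne_zero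
  have hmp := measurePreserving_piFinSuccAbove (fun _ : Fin (q + 1) => gaussianReal 0 1) 0
  have hs : MeasurableSet {y : ℝ × (Fin q → ℝ) | y.1 ^ 2 + ∑ j, y.2 j ^ 2 = c} :=
    measurableSet_eq_fun (by fun_prop) (by fun_prop)
  have h2 := hmp.measure_preimage hs.nullMeasurableSet
  have e : (fun z : Fin (q + 1) → ℝ => ∑ j, z j ^ 2) ⁻¹' {c} =
      (MeasurableEquiv.piFinSuccAbove (fun _ => ℝ) 0) ⁻¹'
        {y : ℝ × (Fin q → ℝ) | y.1 ^ 2 + ∑ j, y.2 j ^ 2 = c} := by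
    ext z
    simp [Fin.sum_univ_succ, MeasurableEquiv.piFinSuccAbove, Fin.insertNthEquiv, Fin.tail]
  rw [e, h2, Measure.prod_apply_symm hs, lintegral_eq_zero_iff
    (measurable_measure_prodMk_right hs)]
  refine ae_of_all _ fun z => ?_
  have hsub : (fun x : ℝ => (x, z)) ⁻¹' {y : ℝ × (Fin q → ℝ) | y.1 ^ 2 + ∑ j, y.2 j ^ 2 = c} ⊆
      {√(c - ∑ j, z j ^ 2), -√(c - ∑ j, z j ^ 2)} := by
    intro x hx
    have hx' : x ^ 2 = c - ∑ j, z j ^ 2 := by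
      simp only [Set.mem_preimage, Set.mem_ofPred_eq] at hx
      linarith
    rw [← hx', Real.sqrt_sq_eq_abs]
    rcases abs_choice x with h | h <;> simp [h]
  exact measure_mono_null hsub (Set.Finite.measure_zero (by simp) _)

lemma chiSquareQuantile_nonneg (q : ℕ) {u : ℝ} (hu : 0 < u) : 0 ≤ chiSquareQuantile q u := by
  refine Real.sInf_nonneg fun x hx => ?_
  by_contra! hneg
  have h0 : (chiSquare q).real (Set.Iic x) = 0 := by
    rw [measureReal_eq_zero_iff]
    exact measure_mono_null (fun y hy => lt_of_le_of_lt hy hneg) (chiSquare_Iio_zero q)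
  have : u ≤ (chiSquare q).real (Set.Iic x) := hx
  linarith

lemma le_chiSquare_Iic_quantile (q : ℕ) {u : ℝ} (hu1 : u < 1) :
    u ≤ (chiSquare q).real (Set.Iic (chiSquareQuantile q u)) := by
  set S := {x : ℝ | u ≤ (chiSquare q).real (Set.Iic x)} with hS
  have hne : S.Nonempty := by
    have h1 := tendsto_cdf_atTop (chiSquare q)
    obtain ⟨x, hx⟩ := (h1.eventually (lt_mem_nhds hu1)).exists
    exact ⟨x, by rw [cdf_eq_real] at hx; exact hx.le⟩
  -- The infimum belongs to the set because distribution functions are right-continuous.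
  have hright : Tendsto (fun x => (chiSquare q).real (Set.Iic x)) (𝓝[>] (sInf S))
      (𝓝 ((chiSquare q).real (Set.Iic (sInf S)))) := by
    have := (cdf (chiSquare q)).right_continuous (sInf S)
    simp_rw [← cdf_eq_real]
    exact this.tendsto.mono_left (nhdsWithin_mono _ Set.Ioi_subset_Ici_self)
  refine ge_of_tendsto hright ?_
  filter_upwards [self_mem_nhdsWithin] with x hx
  obtain ⟨y, hy, hyx⟩ := exists_lt_of_csInf_lt hne hx
  exact le_trans hy (measureReal_mono (Set.Iic_subset_Iic.2 hyx.le))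

lemma chiSquareQuantile_pos (q : ℕ) {u : ℝ} (hu : 0 < u) (hu1 : u < 1) :
    0 < chiSquareQuantile (q + 1) u := by
  refine lt_of_le_of_ne (chiSquareQuantile_nonneg _ hu) fun h0 => ?_
  have h1 := le_chiSquare_Iic_quantile (q + 1) hu1
  rw [← h0, ← Set.Iio_union_right, measureReal_def, measure_union_null (chiSquare_Iio_zero _)
    (chiSquare_singleton q 0)] at h1
  simp at h1
  linarith

lemma le_chiSquare_Iio_quantile (q : ℕ) {u : ℝ} (hu1 : u < 1) :
    ENNReal.ofReal u ≤ chiSquare (q + 1) (Set.Iio (chiSquareQuantile (q + 1) u)) := by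
  have h1 := le_chiSquare_Iic_quantile (q + 1) hu1
  rw [← ENNReal.ofReal_le_ofReal_iff (by positivity), ofReal_measureReal,
    ← Set.Iio_union_right] at h1
  refine h1.trans ((measure_union_le _ _).trans ?_)
  rw [chiSquare_singleton, add_zero]

/-- The mass below the quantile is nearly captured by slightly smaller radii. -/
lemma exists_lt_chiSquare_Iio (q : ℕ) {u v : ℝ} (hu : 0 < u) (hu1 : u < 1) (hv : v < u) :
    ∃ d ∈ Set.Ioo (0 : ℝ) 1, ENNReal.ofReal v <
      chiSquare (q + 1) (Set.Iio (((1 - d) * √(chiSquareQuantile (q + 1) u)) ^ 2)) := by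
  set c := chiSquareQuantile (q + 1) u with hc
  have hc0 : 0 < c := chiSquareQuantile_pos q hu hu1
  have hlt : ENNReal.ofReal v < chiSquare (q + 1) (Set.Iio c) :=
    lt_of_lt_of_le ((ENNReal.ofReal_lt_ofReal_iff hu).2 hv) (le_chiSquare_Iio_quantile q hu1)
  obtain ⟨f, hf, hf', hflim⟩ := exists_seq_strictMono_tendsto' hc0
  have hU : (⋃ n, Set.Iio (f n)) = Set.Iio c := by
    ext x
    simp only [Set.mem_iUnion, Set.mem_Iio]
    refine ⟨fun ⟨n, hn⟩ => hn.trans (hf' n).2, fun hx => ?_⟩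
    exact (hflim.eventually (lt_mem_nhds hx)).exists
  have ht := tendsto_measure_iUnion_atTop (μ := chiSquare (q + 1))
    (s := fun n => Set.Iio (f n)) (fun a b hab => Set.Iio_subset_Iio (hf.monotone hab))
  rw [hU] at ht
  obtain ⟨n, hn⟩ := (ht.eventually (lt_mem_nhds hlt)).exists
  have h1 := (hf' n).1
  have h2 := (hf' n).2
  have hs : 0 < √c := Real.sqrt_pos.2 hc0
  -- Chosen so that `((1 - d) √c) ^ 2 = f n`.
  refine ⟨1 - √(f n) / √c, ⟨?_, ?_⟩, ?_⟩
  · rw [sub_pos, div_lt_one hs]; exact Real.sqrt_lt_sqrt h1.le h2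
  · have : 0 < √(f n) / √c := div_pos (Real.sqrt_pos.2 h1) hs
    linarith
  · have : ((1 - (1 - √(f n) / √c)) * √c) ^ 2 = f n := by
      rw [sub_sub_cancel, div_mul_cancel₀ _ hs.ne', Real.sq_sqrt h1.le]
    rw [this]; exact hn

lemma stdGaussian_ball (q : ℕ) {s : ℝ} (hs : 0 < s) :
    stdGaussian (EuclideanSpace ℝ (Fin q)) {x | ‖x‖ < s} = chiSquare q (Set.Iio (s ^ 2)) := by
  rw [← map_pi_eq_stdGaussian, Measure.map_apply (by fun_prop)
    (measurableSet_lt (by fun_prop) (by fun_prop)), chiSquare,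
    Measure.map_apply (by fun_prop) measurableSet_Iio]
  congr 1
  ext z
  simp only [Set.mem_preimage, Set.mem_ofPred_eq, Set.mem_Iio, EuclideanSpace.norm_eq,
    Real.norm_eq_abs, sq_abs]
  rw [Real.sqrt_lt' hs]

open scoped MatrixOrder in
/-- A Gaussian vector lies in the orthant cut out at `s` standard deviations at least when the
underlying standard vector lies in the ball of radius `s`. -/
lemma chiSquare_le_multivariateGaussian {q : ℕ} {S : Matrix (Fin q) (Fin q) ℝ}
    (hS : S.PosSemidef) (hpos : ∀ l, 0 < S l l) {s : ℝ} (hs : 0 < s) :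
    chiSquare q (Set.Iio (s ^ 2)) ≤
      multivariateGaussian 0 S {w | ∀ l, -(s * √(S l l)) < w l} := by
  have hmeas : MeasurableSet {w : EuclideanSpace ℝ (Fin q) | ∀ l, -(s * √(S l l)) < w l} := by
    simp only [Set.ofPred_forall]
    exact MeasurableSet.iInter fun l => measurableSet_lt (by fun_prop) (by fun_prop)
  rw [← stdGaussian_ball q hs, multivariateGaussian, Measure.map_apply (by fun_prop) hmeas]
  refine measure_mono fun x hx l => ?_
  simp only [Set.mem_ofPred_eq] at hx
  set A := CFC.sqrt S
  have hA : A * A = S := CFC.sqrt_mul_sqrt_self _ hS.nonneg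
  have hAs : A.IsHermitian := (CFC.sqrt_nonneg S).isSelfAdjoint
  -- Row `l` of the square root has norm `√(S l l)`, so Cauchy–Schwarz bounds coordinate `l` by `‖x‖
  -- √(S l l)`.
  have hrow : ∑ j, A l j ^ 2 = S l l := by
    rw [← hA, Matrix.mul_apply]
    refine Finset.sum_congr rfl fun j _ => ?_
    have := hAs.apply l j
    simp only [star_trivial] at this
    rw [sq, this]
  have hval : (0 + Matrix.toEuclideanCLM (𝕜 := ℝ) A x) l = ∑ j, A l j * x j := by
    simp [Matrix.mulVec, dotProduct]
  rw [hval]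
  have hcs := Finset.sum_mul_sq_le_sq_mul_sq Finset.univ (fun j => A l j) (fun j => x j)
  rw [hrow] at hcs
  have hx2 : ∑ j, x j ^ 2 < s ^ 2 := by
    rw [← EuclideanSpace.real_norm_sq_eq]
    exact pow_lt_pow_left₀ hx (norm_nonneg _) two_ne_zero
  have h1 : (∑ j, A l j * x j) ^ 2 < (s * √(S l l)) ^ 2 := by
    rw [mul_pow, Real.sq_sqrt (hpos l).le]
    nlinarith [hpos l]
  exact (abs_lt.1 (abs_lt_of_sq_lt_sq h1 (by positivity))).1

end ChiSquare

/-! ### Asymptotic probability that all scaled sums clear their thresholds. -/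

section Orthant

variable {Ω : Type*} [MeasurableSpace Ω] {P : Measure Ω}

/-- The limiting covariance matrix of a weighted sum of independent samples. -/
noncomputable def limitCov {ι : Type*} [Fintype ι] {q : ℕ} (P : Measure Ω)
    (Z : ι → Ω → EuclideanSpace ℝ (Fin q)) (γ : ι → ℝ) : Matrix (Fin q) (Fin q) ℝ :=
  Matrix.of fun l l' => ∑ p, γ p * ∫ ω, Z p ω l * Z p ω l' ∂P

/-- Matches the exponent of the Gaussian characteristic function with the one-dimensional second
moments produced by the central limit theorem. -/
lemma limitCov_quadratic {ι : Type*} [Fintype ι] {q : ℕ} {Z : ι → Ω → EuclideanSpace ℝ (Fin q)}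
    (hZ : ∀ p l, MemLp (fun ω => Z p ω l) 2 P) (γ : ι → ℝ) (t : EuclideanSpace ℝ (Fin q)) :
    dotProduct t ((limitCov P Z γ).mulVec t) =
      ∑ p, γ p * ∫ ω, inner ℝ (Z p ω) t ^ 2 ∂P := by
  have hint : ∀ p l l', Integrable (fun ω => Z p ω l * Z p ω l') P := fun p l l' =>
    (hZ p l).integrable_mul (hZ p l')
  have e : ∀ p, ∫ ω, inner ℝ (Z p ω) t ^ 2 ∂P =
      ∑ l, ∑ l', (t l * t l') * ∫ ω, Z p ω l * Z p ω l' ∂P := by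
    intro p
    have : ∀ ω, inner ℝ (Z p ω) t ^ 2 =
        ∑ l, ∑ l', (t l * t l') * (Z p ω l * Z p ω l') := by
      intro ω
      simp only [PiLp.inner_apply, RCLike.inner_apply, conj_trivial, sq, Finset.sum_mul_sum]
      refine Finset.sum_congr rfl fun l _ => Finset.sum_congr rfl fun l' _ => by ring
    simp_rw [this]
    rw [integral_finsetSum _ fun l _ => integrable_finsetSum _ fun l' _ =>
      (hint p l l').const_mul _]
    refine Finset.sum_congr rfl fun l _ => ?_
    rw [integral_finsetSum _ fun l' _ => (hint p l l').const_mul _]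
    exact Finset.sum_congr rfl fun l' _ => integral_const_mul _ _
  simp_rw [e]
  simp only [dotProduct, Matrix.mulVec, limitCov, Matrix.of_apply, Finset.mul_sum, Finset.sum_mul]
  have : ∀ l, ∑ l', ∑ p, t l * (γ p * (∫ ω, Z p ω l * Z p ω l' ∂P) * t l') =
      ∑ p, ∑ l', t l * (γ p * (∫ ω, Z p ω l * Z p ω l' ∂P) * t l') :=
    fun l => Finset.sum_comm
  simp_rw [this]
  rw [Finset.sum_comm]
  refine Finset.sum_congr rfl fun p _ => Finset.sum_congr rfl fun l _ =>
    Finset.sum_congr rfl fun l' _ => by ring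

lemma limitCov_posSemidef {ι : Type*} [Fintype ι] {q : ℕ}
    {Z : ι → Ω → EuclideanSpace ℝ (Fin q)} (hZ : ∀ p l, MemLp (fun ω => Z p ω l) 2 P)
    {γ : ι → ℝ} (hγ : ∀ p, 0 ≤ γ p) : (limitCov P Z γ).PosSemidef := by
  refine Matrix.PosSemidef.of_dotProduct_mulVec_nonneg ?_ fun t => ?_
  · ext l l'
    simp [limitCov, mul_comm]
  · have := limitCov_quadratic hZ γ (WithLp.toLp 2 t)
    simp only [star_trivial]
    change 0 ≤ dotProduct (WithLp.toLp 2 t : EuclideanSpace ℝ (Fin q)) _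
    rw [this]
    exact Finset.sum_nonneg fun p _ => mul_nonneg (hγ p)
      (integral_nonneg fun ω => sq_nonneg _)

/-- Convergence of characteristic functions gives weak convergence to a Gaussian; the strict
inequalities make the orthant open, so the portmanteau theorem bounds the liminf below. -/
lemma chiSquare_le_liminf_orthant [IsProbabilityMeasure P] {ι : Type*} [Fintype ι] {q : ℕ}
    {Y : ι → ℕ → Ω → EuclideanSpace ℝ (Fin q)}
    (hY : ∀ p j, AEMeasurable (Y p j) P) (hident : ∀ p j, P.map (Y p j) = P.map (Y p 0))
    (hindep : iIndepFun (fun a : (_ : ι) × ℕ => Y a.1 a.2) P)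
    (hL2 : ∀ p l, MemLp (fun ω => Y p 0 ω l) 2 P) (h0 : ∀ p l, ∫ ω, Y p 0 ω l ∂P = 0)
    {N : ℕ → ι → ℕ} {a : ℕ → ι → ℝ} {γ : ι → ℝ} (hN : ∀ p, Tendsto (fun r => N r p) atTop atTop)
    (ha : ∀ p, Tendsto (fun r => (N r p : ℝ) * a r p ^ 2) atTop (𝓝 (γ p)))
    (hγ : ∀ p, 0 ≤ γ p) (hpos : ∀ l, 0 < limitCov P (fun p => Y p 0) γ l l) {s : ℝ} (hs : 0 < s) :
    chiSquare q (Set.Iio (s ^ 2)) ≤ liminf (fun r => P {ω | ∀ l,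
      -(s * √(limitCov P (fun p => Y p 0) γ l l)) <
        ∑ p, ∑ j : Fin (N r p), a r p * Y p j ω l}) atTop := by
  set S := limitCov P (fun p => Y p 0) γ with hSdef
  have hS : S.PosSemidef := limitCov_posSemidef hL2 hγ
  set W : ℕ → Ω → EuclideanSpace ℝ (Fin q) :=
    fun r ω => ∑ p, ∑ j : Fin (N r p), a r p • Y p j ω with hW
  have hWm : ∀ r, AEMeasurable (W r) P := fun r =>
    Finset.aemeasurable_fun_sum _ fun p _ => Finset.aemeasurable_fun_sum _ fun j _ =>
      (hY p j).const_smul (a r p)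
  have hinner : ∀ p (t : EuclideanSpace ℝ (Fin q)),
      (fun ω => inner ℝ (Y p 0 ω) t) = fun ω => ∑ l, t l * Y p 0 ω l := by
    intro p t
    funext ω
    simp [PiLp.inner_apply]
  have hL2' : ∀ p (t : EuclideanSpace ℝ (Fin q)), MemLp (fun ω => inner ℝ (Y p 0 ω) t) 2 P := by
    intro p t
    rw [hinner]
    exact memLp_finsetSum _ fun l _ => (hL2 p l).const_mul _
  have h0' : ∀ p (t : EuclideanSpace ℝ (Fin q)), ∫ ω, inner ℝ (Y p 0 ω) t ∂P = 0 := by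
    intro p t
    rw [hinner, integral_finsetSum _ fun l _ =>
      ((hL2 p l).integrable one_le_two).const_mul _]
    simp [integral_const_mul, h0]
  let μ : ℕ → ProbabilityMeasure (EuclideanSpace ℝ (Fin q)) := fun r =>
    ⟨P.map (W r), Measure.isProbabilityMeasure_map (hWm r)⟩
  let μ₀ : ProbabilityMeasure (EuclideanSpace ℝ (Fin q)) :=
    ⟨multivariateGaussian 0 S, inferInstance⟩
  have hlim : Tendsto μ atTop (𝓝 μ₀) := by
    refine ProbabilityMeasure.tendsto_iff_tendsto_charFun.2 fun t => ?_
    have h1 := tendsto_charFun_weighted_sum hY hident hindep t (fun p => hL2' p t)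
      (fun p => h0' p t) hN ha
    have h2 : charFun (multivariateGaussian 0 S) t =
        Complex.exp ((-(∑ p, γ p * ∫ ω, inner ℝ (Y p 0 ω) t ^ 2 ∂P) / 2 : ℝ)) := by
      rw [charFun_multivariateGaussian hS, ← limitCov_quadratic hL2]
      congr 1
      simp [neg_div, hSdef]
    change Tendsto (fun r => charFun (P.map (W r)) t) atTop
      (𝓝 (charFun (multivariateGaussian 0 S) t))
    rw [h2]
    exact h1
  have hopen : IsOpen {w : EuclideanSpace ℝ (Fin q) | ∀ l, -(s * √(S l l)) < w l} := by
    simp only [Set.ofPred_forall]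
    exact isOpen_iInter_of_finite fun l => isOpen_lt (by fun_prop) (by fun_prop)
  have h3 := ProbabilityMeasure.le_liminf_measure_open_of_tendsto hlim hopen
  refine (chiSquare_le_multivariateGaussian hS hpos hs).trans (h3.trans_eq ?_)
  congr 1
  funext r
  change P.map (W r) _ = _
  rw [Measure.map_apply_of_aemeasurable (hWm r) hopen.measurableSet]
  congr 1
  ext ω
  simp [hW]

end Orthant

/-! ### Tilted weights: cost, gain and eventual admissibility. -/

section Tilt

/-- The sample mean. -/
noncomputable def sampleMean {n : ℕ} (y : Fin n → ℝ) : ℝ := (∑ j, y j) / n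

/-- The sample variance. -/
noncomputable def sampleVar {n : ℕ} (y : Fin n → ℝ) : ℝ := (∑ j, (y j - sampleMean y) ^ 2) / n

/-- The empirical weights tilted linearly in the centred data. -/
noncomputable def tilt {n : ℕ} (τ : ℝ) (y : Fin n → ℝ) (j : Fin n) : ℝ :=
  (1 + τ * (y j - sampleMean y)) / n

lemma sum_sub_sampleMean {n : ℕ} (y : Fin n → ℝ) : ∑ j, (y j - sampleMean y) = 0 := by
  rcases Nat.eq_zero_or_pos n with rfl | hn
  · simp
  · have : (n : ℝ) ≠ 0 := by positivity
    simp only [Finset.sum_sub_distrib, Finset.sum_const, Finset.card_univ, Fintype.card_fin,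
      nsmul_eq_mul, sampleMean]
    field_simp
    ring

lemma sampleVar_eq {n : ℕ} (y : Fin n → ℝ) :
    sampleVar y = (∑ j, y j ^ 2) / n - sampleMean y ^ 2 := by
  rcases Nat.eq_zero_or_pos n with rfl | hn
  · simp [sampleVar, sampleMean]
  · have hn' : (n : ℝ) ≠ 0 := by positivity
    have h : ∑ j, y j = n * sampleMean y := by simp only [sampleMean]; field_simp
    have : ∑ j, (y j - sampleMean y) ^ 2 = ∑ j, y j ^ 2 - n * sampleMean y ^ 2 := by
      simp only [sub_sq, Finset.sum_add_distrib, Finset.sum_sub_distrib, Finset.sum_const,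
        Finset.card_univ, Fintype.card_fin, nsmul_eq_mul, ← Finset.sum_mul, ← Finset.mul_sum, h]
      ring
    rw [sampleVar, this, sub_div, mul_div_cancel_left₀ _ hn']

lemma sum_tilt {n : ℕ} (hn : 0 < n) (τ : ℝ) (y : Fin n → ℝ) : ∑ j, tilt τ y j = 1 := by
  have hn' : (n : ℝ) ≠ 0 := by positivity
  simp only [tilt, ← Finset.sum_div, Finset.sum_add_distrib, ← Finset.mul_sum, sum_sub_sampleMean]
  simp [hn']

lemma sum_tilt_mul {n : ℕ} (τ : ℝ) (y : Fin n → ℝ) :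
    ∑ j, tilt τ y j * y j = sampleMean y + τ * sampleVar y := by
  have h1 : ∑ j, (y j - sampleMean y) * y j = ∑ j, (y j - sampleMean y) ^ 2 := by
    have : ∑ j, ((y j - sampleMean y) * y j - (y j - sampleMean y) ^ 2) =
        (∑ j, (y j - sampleMean y)) * sampleMean y := by
      rw [Finset.sum_mul]
      exact Finset.sum_congr rfl fun j _ => by ring
    rw [sum_sub_sampleMean, zero_mul, Finset.sum_sub_distrib] at this
    linarith
  have h2 : ∀ j, tilt τ y j * y j = y j / n + τ * ((y j - sampleMean y) * y j / n) := by
    intro j; simp only [tilt]; ring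
  simp_rw [h2]
  rw [Finset.sum_add_distrib, ← Finset.mul_sum, ← Finset.sum_div, ← Finset.sum_div, h1]
  rfl

lemma neg_two_mul_log_one_add_le {x ρ : ℝ} (hx : |x| ≤ ρ) (hρ : ρ ≤ 1 / 2) :
    -2 * Real.log (1 + x) ≤ -2 * x + (1 + 4 * ρ) * x ^ 2 := by
  have h := Real.abs_log_sub_add_sum_range_le (x := -x) (by rw [abs_neg]; linarith) 2
  simp only [Finset.sum_range_succ, Finset.sum_range_zero, abs_neg, sub_neg_eq_add] at h
  norm_num at h
  have h1 := (abs_le.1 h).1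
  -- The second-order Taylor remainder of the logarithm; `1 - |x| ≥ 1/2` supplies the factor 2.
  have h2 : |x| ^ 3 / (1 - |x|) ≤ 2 * ρ * x ^ 2 := by
    rw [div_le_iff₀ (by linarith), ← sq_abs x]
    have h0 := abs_nonneg x
    nlinarith [mul_nonneg (sq_nonneg |x|) h0, mul_nonneg (sq_nonneg |x|) (sub_nonneg.2 hx),
      mul_nonneg (mul_nonneg (sq_nonneg |x|) (h0.trans hx)) (by linarith : 0 ≤ 1 - 2 * |x|)]
  linarith

/-- The linear terms of the logarithms cancel because the data are centred. -/
lemma neg_two_mul_sum_log_tilt_le {n : ℕ} (hn : 0 < n) {τ ρ : ℝ} {y : Fin n → ℝ}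
    (hy : ∀ j, |τ * (y j - sampleMean y)| ≤ ρ) (hρ : ρ ≤ 1 / 2) :
    -2 * ∑ j, Real.log (n * tilt τ y j) ≤ (1 + 4 * ρ) * (τ ^ 2 * (n * sampleVar y)) := by
  have hn' : (n : ℝ) ≠ 0 := by positivity
  have h1 : ∀ j, n * tilt τ y j = 1 + τ * (y j - sampleMean y) := by
    intro j; simp only [tilt]; field_simp
  simp_rw [h1, Finset.mul_sum]
  refine (Finset.sum_le_sum fun j _ => neg_two_mul_log_one_add_le (hy j) hρ).trans_eq ?_
  rw [Finset.sum_add_distrib, ← Finset.mul_sum, ← Finset.mul_sum, ← Finset.mul_sum,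
    sum_sub_sampleMean, sampleVar, mul_div_cancel₀ _ hn', Finset.mul_sum]
  simp [mul_pow, Finset.mul_sum]

/-- Applied to squared data, this bounds the largest observation by `o(√n)`, which keeps the tilts
uniformly small. -/
lemma eventually_forall_lt_le {a : ℕ → ℝ}
    (ha : Tendsto (fun n : ℕ => a n / n) atTop (𝓝 0)) {κ : ℝ} (hκ : 0 < κ) :
    ∀ᶠ n : ℕ in atTop, ∀ j < n, a j ≤ κ * n := by
  obtain ⟨M, hM⟩ := eventually_atTop.1 (ha.eventually (gt_mem_nhds hκ))
  have h1 : ∀ᶠ n : ℕ in atTop, ∀ j ∈ Finset.range (M + 1), a j ≤ κ * n := by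
    rw [eventually_all_finset]
    intro j _
    exact (tendsto_natCast_atTop_atTop.const_mul_atTop hκ).eventually_ge_atTop _
  filter_upwards [h1] with n hn j hj
  rcases lt_or_ge j (M + 1) with h | h
  · exact hn j (Finset.mem_range.2 h)
  · have h2 := hM j (by omega)
    have hj0 : (0 : ℝ) < j := by exact_mod_cast (show 0 < j by omega)
    rw [div_lt_iff₀ hj0] at h2
    have : (j : ℝ) ≤ n := by exact_mod_cast hj.le
    nlinarith

/-- Subtract consecutive averages. -/
lemma tendsto_div_of_tendsto_avg {a : ℕ → ℝ} {v : ℝ}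
    (ha : Tendsto (fun n : ℕ => (∑ j ∈ Finset.range n, a j) / n) atTop (𝓝 v)) :
    Tendsto (fun n : ℕ => a n / n) atTop (𝓝 0) := by
  have h1 : Tendsto (fun n : ℕ => (∑ j ∈ Finset.range (n + 1), a j) / ((n + 1 : ℕ) : ℝ)) atTop
    (𝓝 v) := ha.comp (tendsto_add_atTop_nat 1)
  have h2 : Tendsto (fun n : ℕ => ((n + 1 : ℕ) : ℝ) / n) atTop (𝓝 1) := by
    have := (tendsto_inv_atTop_nhds_zero_nat (𝕜 := ℝ)).const_add 1
    rw [add_zero] at this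
    refine this.congr' ?_
    filter_upwards [eventually_ne_atTop 0] with n hn
    have : (n : ℝ) ≠ 0 := by exact_mod_cast hn
    push_cast
    field_simp
  have h3 := (h1.mul h2).sub ha
  rw [mul_one, sub_self] at h3
  refine h3.congr' ?_
  filter_upwards [eventually_ne_atTop 0] with n hn
  have : (n : ℝ) ≠ 0 := by exact_mod_cast hn
  have h4 : ((n + 1 : ℕ) : ℝ) ≠ 0 := by positivity
  rw [Finset.sum_range_succ]
  field_simp
  ring

variable {m : ℕ}

/-- The samples whose tilted weights are admissible and raise the sum of the means by `g / √A`. -/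
def tiltSet (N : Fin m → ℕ) (A lam c g : ℝ) : Set (∀ p, Fin (N p) → ℝ) :=
  {y | (fun p => tilt (lam * √A / N p) (y p)) ∈ ambiguitySet N c ∧
    g ≤ √A * ∑ p, lam * √A / N p * sampleVar (y p)}

lemma measurableSet_ambiguitySet (N : Fin m → ℕ) (c : ℝ) : MeasurableSet (ambiguitySet N c) := by
  have e : ambiguitySet N c = (⋂ p, (fun w => w p) ⁻¹' stdSimplex ℝ (Fin (N p))) ∩
      ((⋂ p, ⋂ j, {w | 0 < w p j}) ∩
        {w | -2 * ∑ p, ∑ j, Real.log ((N p : ℝ) * w p j) ≤ c}) := by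
    ext w
    simp [ambiguitySet]
  rw [e]
  refine MeasurableSet.inter ?_ (MeasurableSet.inter ?_ ?_)
  · exact MeasurableSet.iInter fun p =>
      (isClosed_stdSimplex ℝ (Fin (N p))).measurableSet.preimage (measurable_pi_apply p)
  · exact MeasurableSet.iInter fun p => MeasurableSet.iInter fun j =>
      measurableSet_lt measurable_const (by fun_prop)
  · exact measurableSet_le (by fun_prop) measurable_const

lemma measurableSet_tiltSet (N : Fin m → ℕ) (A lam c g : ℝ) :
    MeasurableSet (tiltSet N A lam c g) := by
  have hmean : ∀ p, Measurable fun y : ∀ p, Fin (N p) → ℝ => sampleMean (y p) := by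
    intro p; unfold sampleMean; fun_prop
  have e : tiltSet N A lam c g =
      (fun (y : ∀ p, Fin (N p) → ℝ) p => tilt (lam * √A / N p) (y p)) ⁻¹' ambiguitySet N c ∩
        {y | g ≤ √A * ∑ p, lam * √A / N p * sampleVar (y p)} := rfl
  rw [e]
  refine MeasurableSet.inter ((measurableSet_ambiguitySet N c).preimage ?_)
    (measurableSet_le measurable_const ?_)
  · unfold tilt
    refine measurable_pi_lambda _ fun p => measurable_pi_lambda _ fun j => ?_
    have := hmean p
    fun_prop
  · unfold sampleVar
    fun_prop

lemma eventually_mem_tiltSet {y : Fin m → ℕ → ℝ} {v : Fin m → ℝ}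
    (hmean : ∀ p, Tendsto (fun n : ℕ => (∑ j ∈ Finset.range n, y p j) / n) atTop (𝓝 0))
    (hsq : ∀ p, Tendsto (fun n : ℕ => (∑ j ∈ Finset.range n, y p j ^ 2) / n) atTop (𝓝 (v p)))
    {N : ℕ → Fin m → ℕ} (hN : ∀ p, Tendsto (fun r => N r p) atTop atTop) {A : ℕ → ℝ}
    (hA : Tendsto A atTop atTop) {γ : Fin m → ℝ}
    (hγ : ∀ p, Tendsto (fun r => A r / N r p) atTop (𝓝 (γ p)))
    {c d : ℝ} (hc : 0 < c) (hd : d ∈ Set.Ioo (0 : ℝ) 1) (hσ : 0 < ∑ p, γ p * v p) :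
    ∀ᶠ r in atTop, (fun p (j : Fin (N r p)) => y p j) ∈
      tiltSet (N r) (A r) ((1 - d / 2) * √c / √(∑ p, γ p * v p)) c
        ((1 - d) * √c * √(∑ p, γ p * v p)) := by
  set σ := √(∑ p, γ p * v p) with hσd
  have hσ0 : 0 < σ := Real.sqrt_pos.2 hσ
  have hσ2 : σ ^ 2 = ∑ p, γ p * v p := Real.sq_sqrt hσ.le
  have hc0 : 0 < √c := Real.sqrt_pos.2 hc
  have hc2 : √c ^ 2 = c := Real.sq_sqrt hc.le
  set lam := (1 - d / 2) * √c / σ with hlam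
  have hd1 : 0 < 1 - d / 2 := by linarith [hd.2]
  have hlam0 : 0 < lam := by positivity
  have hm : ∀ p, Tendsto (fun r => sampleMean fun j : Fin (N r p) => y p j) atTop (𝓝 0) := by
    intro p
    refine ((hmean p).comp (hN p)).congr fun r => ?_
    simp [sampleMean, Finset.sum_range]
  have hv : ∀ p, Tendsto (fun r => sampleVar fun j : Fin (N r p) => y p j) atTop (𝓝 (v p)) := by
    intro p
    have h1 := ((hsq p).comp (hN p)).sub ((hm p).pow 2)
    rw [zero_pow two_ne_zero, sub_zero] at h1
    refine h1.congr fun r => ?_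
    rw [sampleVar_eq]
    simp [Finset.sum_range]
  have hQ : Tendsto (fun r => ∑ p, A r / N r p * sampleVar fun j : Fin (N r p) => y p j) atTop
      (𝓝 (σ ^ 2)) := by
    rw [hσ2]
    exact tendsto_finsetSum _ fun p _ => (hγ p).mul (hv p)
  obtain ⟨ρ, hρ0, hρ1, hρ2⟩ : ∃ ρ : ℝ, 0 < ρ ∧ ρ ≤ 1 / 2 ∧
      (1 + 4 * ρ) * (lam ^ 2 * σ ^ 2) < c := by
    have e : lam ^ 2 * σ ^ 2 = (1 - d / 2) ^ 2 * c := by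
      rw [hlam, div_pow, mul_pow, hc2]
      field_simp
    rw [e]
    -- With `ρ = d / 8` the cost factor is `(1 + d/2) (1 - d/2)² = (1 - d²/4) (1 - d/2) < 1`.
    refine ⟨d / 8, by linarith [hd.1], by linarith [hd.2], ?_⟩
    have : (1 + 4 * (d / 8)) * (1 - d / 2) ^ 2 < 1 := by
      have h1 := hd.1
      have h2 := hd.2
      nlinarith [mul_pos h1 h1, mul_pos h1 hd1]
    nlinarith
  have hcost : ∀ᶠ r in atTop, (1 + 4 * ρ) * (lam ^ 2 *
      ∑ p, A r / N r p * sampleVar fun j : Fin (N r p) => y p j) < c :=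
    ((hQ.const_mul _).const_mul _).eventually (gt_mem_nhds hρ2)
  have hgain : ∀ᶠ r in atTop, (1 - d) * √c * σ <
      lam * ∑ p, A r / N r p * sampleVar fun j : Fin (N r p) => y p j := by
    refine (hQ.const_mul lam).eventually (lt_mem_nhds ?_)
    have e : lam * σ ^ 2 = (1 - d / 2) * √c * σ := by
      rw [hlam]; field_simp
    rw [e]
    have := mul_pos hc0 hσ0
    nlinarith [hd.1]
  have hsmall : ∀ p, ∀ᶠ r in atTop, ∀ j : Fin (N r p),
      |lam * √(A r) / N r p * (y p j - sampleMean fun j : Fin (N r p) => y p j)| ≤ ρ := by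
    intro p
    set B := γ p + 1 with hB
    have hB1 : ∀ᶠ r in atTop, A r / N r p < B :=
      (hγ p).eventually (gt_mem_nhds (by rw [hB]; linarith))
    -- Solves `lam² (|B| + 1) · 4κ = ρ²`, where `4κ` will bound `(y - mean)² / N` through `(a - b)²
    -- ≤ 2a² + 2b²` and `N ≥ 1`.
    set κ := ρ ^ 2 / (4 * lam ^ 2 * (|B| + 1)) with hκ
    have hκ0 : 0 < κ := by positivity
    have h1 := (hN p).eventually (eventually_forall_lt_le (tendsto_div_of_tendsto_avg (hsq p)) hκ0)
    have h2 : ∀ᶠ r in atTop, (sampleMean fun j : Fin (N r p) => y p j) ^ 2 < κ := by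
      refine ((hm p).pow 2).eventually (gt_mem_nhds ?_)
      simpa using hκ0
    filter_upwards [hB1, h1, h2, hA.eventually_gt_atTop 0, (hN p).eventually_gt_atTop 0]
      with r hB1 h1 h2 hA0 hN0 j
    set μ := sampleMean fun j : Fin (N r p) => y p j
    have hy := h1 j j.2
    have hN1 : (1 : ℝ) ≤ N r p := by exact_mod_cast hN0
    have hNp : (0 : ℝ) < N r p := by linarith
    refine abs_le_of_sq_le_sq ?_ hρ0.le
    have h3 : (y p j - μ) ^ 2 ≤ 4 * κ * N r p := by
      nlinarith [sq_nonneg (y p j + μ)]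
    have h4 : (lam * √(A r) / N r p * (y p j - μ)) ^ 2 =
        lam ^ 2 * (A r / N r p) * ((y p j - μ) ^ 2 / N r p) := by
      rw [mul_pow, div_pow, mul_pow, Real.sq_sqrt hA0.le]
      field_simp
    have h5 : (y p j - μ) ^ 2 / N r p ≤ 4 * κ := by
      rw [div_le_iff₀ hNp]; exact h3
    have h6 : A r / N r p ≤ |B| + 1 := by linarith [le_abs_self B]
    rw [h4]
    calc lam ^ 2 * (A r / N r p) * ((y p j - μ) ^ 2 / N r p)
        ≤ lam ^ 2 * (|B| + 1) * (4 * κ) := by gcongr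
      _ = ρ ^ 2 := by rw [hκ]; field_simp
  filter_upwards [hcost, hgain, eventually_all.2 hsmall, hA.eventually_gt_atTop 0,
    eventually_all.2 fun p => (hN p).eventually_gt_atTop 0] with r hcost hgain hsmall hA0 hN0
  have hNp : ∀ p, (0 : ℝ) < N r p := fun p => by exact_mod_cast hN0 p
  have htp : ∀ p (j : Fin (N r p)),
      0 < tilt (lam * √(A r) / N r p) (fun j : Fin (N r p) => y p j) j := by
    intro p j
    refine div_pos ?_ (hNp p)
    have := (abs_le.1 (hsmall p j)).1
    linarith
  refine ⟨⟨fun p => ⟨fun j => (htp p j).le, sum_tilt (hN0 p) _ _⟩, htp, ?_⟩, ?_⟩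
  · rw [Finset.mul_sum]
    refine (Finset.sum_le_sum fun p _ =>
      neg_two_mul_sum_log_tilt_le (hN0 p) (hsmall p) hρ1).trans ?_
    rw [← Finset.mul_sum]
    refine le_of_eq_of_le ?_ hcost.le
    congr 1
    rw [Finset.mul_sum]
    refine Finset.sum_congr rfl fun p _ => ?_
    have := hNp p
    rw [div_pow, mul_pow, Real.sq_sqrt hA0.le]
    field_simp
  · refine hgain.le.trans_eq ?_
    rw [Finset.mul_sum, Finset.mul_sum]
    refine Finset.sum_congr rfl fun p _ => ?_
    have := hNp p
    have h2 := Real.mul_self_sqrt hA0.le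
    rw [← mul_assoc, ← mul_assoc]
    congr 1
    rw [show √(A r) * (lam * √(A r) / N r p) = lam * (√(A r) * √(A r)) / N r p by ring, h2]
    ring

end Tilt

/-! ### Tilts are admissible with probability tending to one. -/

section Probability

variable {Ω : Type*} [MeasurableSpace Ω] {P : Measure Ω}

/-- The tail unions of the complements decrease to a null set; continuity from above. -/
lemma tendsto_measure_compl_of_eventually_mem [IsFiniteMeasure P] {C : ℕ → Set Ω}
    (hC : ∀ r, NullMeasurableSet (C r) P) (h : ∀ᵐ ω ∂P, ∀ᶠ r in atTop, ω ∈ C r) :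
    Tendsto (fun r => P (C r)ᶜ) atTop (𝓝 0) := by
  set B : ℕ → Set Ω := fun n => ⋃ r ≥ n, (C r)ᶜ with hB
  have hBm : ∀ n, NullMeasurableSet (B n) P := fun n =>
    NullMeasurableSet.iUnion fun r => NullMeasurableSet.iUnion fun _ => (hC r).compl
  have hanti : Antitone B := fun a b hab =>
    Set.iUnion_mono fun r => Set.iUnion_mono' fun h => ⟨hab.trans h, le_rfl⟩
  have h0 : P (⋂ n, B n) = 0 := by
    refine measure_mono_null ?_ h
    intro ω hω hev
    obtain ⟨n, hn⟩ := eventually_atTop.1 hev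
    have := Set.mem_iInter.1 hω n
    simp only [hB, Set.mem_iUnion] at this
    obtain ⟨r, hr, hr'⟩ := this
    exact hr' (hn r hr)
  have ht := tendsto_measure_iInter_atTop (μ := P) hBm hanti ⟨0, measure_ne_top _ _⟩
  rw [h0] at ht
  refine tendsto_of_tendsto_of_tendsto_of_le_of_le tendsto_const_nhds ht (fun _ => zero_le) ?_
  intro r
  exact measure_mono (Set.subset_iUnion₂_of_subset r le_rfl subset_rfl)

lemma tendsto_measure_compl_tiltSet [IsProbabilityMeasure P] {m : ℕ} {Y : Fin m → ℕ → Ω → ℝ}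
    (hY : ∀ p j, AEMeasurable (Y p j) P) (hident : ∀ p j, P.map (Y p j) = P.map (Y p 0))
    (hindep : iIndepFun (fun a : (_ : Fin m) × ℕ => Y a.1 a.2) P)
    (hL2 : ∀ p, MemLp (Y p 0) 2 P) (h0 : ∀ p, ∫ ω, Y p 0 ω ∂P = 0)
    {N : ℕ → Fin m → ℕ} (hN : ∀ p, Tendsto (fun r => N r p) atTop atTop) {A : ℕ → ℝ}
    (hA : Tendsto A atTop atTop) {γ : Fin m → ℝ}
    (hγ : ∀ p, Tendsto (fun r => A r / N r p) atTop (𝓝 (γ p))) {c d : ℝ} (hc : 0 < c)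
    (hd : d ∈ Set.Ioo (0 : ℝ) 1) (hσ : 0 < ∑ p, γ p * ∫ ω, Y p 0 ω ^ 2 ∂P) :
    Tendsto (fun r => P {ω | (fun p (j : Fin (N r p)) => Y p j ω) ∈
      tiltSet (N r) (A r) ((1 - d / 2) * √c / √(∑ p, γ p * ∫ ω, Y p 0 ω ^ 2 ∂P)) c
        ((1 - d) * √c * √(∑ p, γ p * ∫ ω, Y p 0 ω ^ 2 ∂P))}ᶜ) atTop (𝓝 0) := by
  refine tendsto_measure_compl_of_eventually_mem (fun r => ?_) ?_
  · have : AEMeasurable (fun ω p (j : Fin (N r p)) => Y p j ω) P :=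
      aemeasurable_pi_lambda _ fun p => aemeasurable_pi_lambda _ fun j => hY p j
    exact this.nullMeasurableSet_preimage (measurableSet_tiltSet _ _ _ _ _)
  · have hid : ∀ p j, IdentDistrib (Y p j) (Y p 0) P P := fun p j => ⟨hY p j, hY p 0, hident p j⟩
    have hpair : ∀ p, Pairwise (Function.onFun (· ⟂ᵢ[P] ·) (Y p)) := by
      intro p j j' hjj
      have hne : (⟨p, j⟩ : (_ : Fin m) × ℕ) ≠ ⟨p, j'⟩ := by simpa using hjj
      exact hindep.indepFun hne
    have h1 : ∀ᵐ ω ∂P, ∀ p,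
        Tendsto (fun n : ℕ => (∑ j ∈ Finset.range n, Y p j ω) / n) atTop (𝓝 0) := by
      refine ae_all_iff.2 fun p => ?_
      have := strong_law_ae_real (Y p) ((hL2 p).integrable one_le_two) (hpair p) (hid p)
      rwa [h0 p] at this
    have h2 : ∀ᵐ ω ∂P, ∀ p, Tendsto (fun n : ℕ => (∑ j ∈ Finset.range n, Y p j ω ^ 2) / n) atTop
        (𝓝 (∫ ω, Y p 0 ω ^ 2 ∂P)) := by
      refine ae_all_iff.2 fun p => ?_
      refine strong_law_ae_real (fun j ω => Y p j ω ^ 2) (hL2 p).integrable_sq ?_ ?_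
      · intro j j' hjj
        exact (hpair p hjj).comp (φ := fun x => x ^ 2) (ψ := fun x => x ^ 2)
          (by fun_prop) (by fun_prop)
      · intro j
        exact (hid p j).comp (u := fun x => x ^ 2) (by fun_prop)
    filter_upwards [h1, h2] with ω h1 h2
    exact eventually_mem_tiltSet h1 h2 hN hA hγ hc hd hσ

end Probability

/-! ### Compactness of the ambiguity set and the coverage certificate. -/

section Attainment

variable {m : ℕ}

/-- Exponentiating turns the likelihood bound into a closed condition: a product bounded below by a
positive number already forces every weight to be positive. This absorbs the open positivity
constraint and yields compactness. -/
lemma ambiguitySet_eq {N : Fin m → ℕ} (hN : ∀ p, 0 < N p) (c : ℝ) :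
    ambiguitySet N c = (Set.univ.pi fun p => stdSimplex ℝ (Fin (N p))) ∩
      {w | Real.exp (-c / 2) ≤ ∏ p, ∏ j, ((N p : ℝ) * w p j)} := by
  have hNp : ∀ p, (0 : ℝ) < N p := fun p => by exact_mod_cast hN p
  ext w
  simp only [ambiguitySet, Set.mem_inter_iff, Set.mem_univ_pi, Set.mem_ofPred_eq]
  refine and_congr_right fun hw => ?_
  have key : (∀ p j, 0 < w p j) → (-2 * ∑ p, ∑ j, Real.log ((N p : ℝ) * w p j) ≤ c ↔
      Real.exp (-c / 2) ≤ ∏ p, ∏ j, ((N p : ℝ) * w p j)) := by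
    intro hpos
    have hpos' : ∀ p, 0 < ∏ j, ((N p : ℝ) * w p j) := fun p =>
      Finset.prod_pos fun j _ => mul_pos (hNp p) (hpos p j)
    have hlog : ∑ p, ∑ j, Real.log ((N p : ℝ) * w p j) =
        Real.log (∏ p, ∏ j, ((N p : ℝ) * w p j)) := by
      rw [Real.log_prod fun p _ => (hpos' p).ne']
      refine Finset.sum_congr rfl fun p _ => ?_
      rw [Real.log_prod fun j _ => (mul_pos (hNp p) (hpos p j)).ne']
    rw [hlog, ← Real.le_log_iff_exp_le (Finset.prod_pos fun p _ => hpos' p)]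
    constructor <;> intro h <;> linarith
  refine ⟨fun h => (key h.1).1 h.2, fun h => ?_⟩
  have hpos : ∀ p j, 0 < w p j := by
    intro p j
    refine lt_of_le_of_ne ((hw p).1 j) fun h0 => ?_
    have : ∏ p, ∏ j, ((N p : ℝ) * w p j) = 0 :=
      Finset.prod_eq_zero (Finset.mem_univ p)
        (Finset.prod_eq_zero (Finset.mem_univ j) (by rw [← h0, mul_zero]))
    rw [this] at h
    exact absurd h (not_le.2 (Real.exp_pos _))
  exact ⟨hpos, (key hpos).2 h⟩

lemma isCompact_ambiguitySet {N : Fin m → ℕ} (hN : ∀ p, 0 < N p) (c : ℝ) :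
    IsCompact (ambiguitySet N c) := by
  rw [ambiguitySet_eq hN]
  refine (isCompact_univ_pi fun p => isCompact_stdSimplex ℝ (Fin (N p))).inter_right ?_
  exact isClosed_le continuous_const (by fun_prop)

lemma ambiguitySet_nonempty {N : Fin m → ℕ} (hN : ∀ p, 0 < N p) {c : ℝ} (hc : 0 ≤ c) :
    (ambiguitySet N c).Nonempty := by
  have hNp : ∀ p, (0 : ℝ) < N p := fun p => by exact_mod_cast hN p
  refine ⟨fun p _ => 1 / N p, fun p => ⟨fun j => ?_, ?_⟩, fun p j => ?_, ?_⟩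
  · have := hNp p; positivity
  · have := hNp p; simp; field_simp
  · have := hNp p; positivity
  · have : ∀ p, (N p : ℝ) * (1 / N p) = 1 := fun p => mul_one_div_cancel (hNp p).ne'
    simpa only [this, Real.log_one, Finset.sum_const_zero, mul_zero] using hc

variable {Ξ : Fin m → Type*} [∀ p, MeasurableSpace (Ξ p)] [∀ p, MeasurableSingletonClass (Ξ p)]

/-- Measurable points allow integration against Dirac masses without measurability of the influence
function. -/
lemma linearized_reweighted (T : Fin m → ℕ) (h : (∀ p, Fin (T p) → Ξ p) → ℝ)
    (F : ∀ p, Measure (Ξ p)) {N : Fin m → ℕ} (x : ∀ p, Fin (N p) → Ξ p)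
    {w : ∀ p, Fin (N p) → ℝ} (hw : ∀ p j, 0 ≤ w p j) :
    linearized T h (reweighted x w) F =
      perf T h F + ∑ p, ∑ j, w p j * influence T h F p (x p j) := by
  unfold linearized reweighted
  congr 1
  refine Finset.sum_congr rfl fun p _ => ?_
  rw [integral_finsetSum_measure fun j _ =>
    (integrable_dirac (by simp)).smul_measure ENNReal.ofReal_ne_top]
  refine Finset.sum_congr rfl fun j _ => ?_
  rw [integral_smul_measure, integral_dirac, ENNReal.toReal_ofReal (hw p j), smul_eq_mul]

variable {T₁ T₂ : Fin m → ℕ} {h₁ : (∀ p, Fin (T₁ p) → Ξ p) → ℝ}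
  {h₂ : (∀ p, Fin (T₂ p) → Ξ p) → ℝ} {F : ∀ p, Measure (Ξ p)}
  {N : Fin m → ℕ} {x : ∀ p, Fin (N p) → Ξ p} {c : ℝ}

lemma linearized_sub_linearized {w : ∀ p, Fin (N p) → ℝ} (hw : w ∈ ambiguitySet N c) :
    linearized T₁ h₁ (reweighted x w) F - linearized T₂ h₂ (reweighted x w) F =
      perf T₁ h₁ F - perf T₂ h₂ F + ∑ p, ∑ j, w p j *
        (influence T₁ h₁ F p (x p j) - influence T₂ h₂ F p (x p j)) := by
  rw [linearized_reweighted _ _ _ _ fun p j => (hw.2.1 p j).le,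
    linearized_reweighted _ _ _ _ fun p j => (hw.2.1 p j).le]
  simp only [mul_sub, Finset.sum_sub_distrib]
  ring

lemma isGreatest_worstCaseGap (hN : ∀ p, 0 < N p) (hc : 0 ≤ c) :
    IsGreatest (gapValues T₁ T₂ h₁ h₂ F x c) (worstCaseGap T₁ T₂ h₁ h₂ F x c) := by
  have hcomp : IsCompact (gapValues T₁ T₂ h₁ h₂ F x c) := by
    refine (isCompact_ambiguitySet hN c).image_of_continuousOn ?_
    -- The objective agrees with an affine function only where the weights are nonnegative, since
    -- `reweighted` truncates through `ENNReal.ofReal`.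
    refine ContinuousOn.congr (f := fun w => perf T₁ h₁ F - perf T₂ h₂ F + ∑ p, ∑ j, w p j *
        (influence T₁ h₁ F p (x p j) - influence T₂ h₂ F p (x p j))) ?_
        fun w hw => linearized_sub_linearized hw
    fun_prop
  exact hcomp.isGreatest_sSup ((ambiguitySet_nonempty hN hc).image _)

/-- An admissible tilt certifies that the worst case covers the true difference. -/
lemma perf_sub_le_worstCaseGap (hN : ∀ p, 0 < N p) (hc : 0 ≤ c) {A lam g : ℝ} (hA : 0 < A)
    (hx : (fun p j => influence T₁ h₁ F p (x p j) - influence T₂ h₂ F p (x p j)) ∈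
      tiltSet N A lam c g)
    (hg : -g < ∑ p, ∑ j, √A / N p *
      (influence T₁ h₁ F p (x p j) - influence T₂ h₂ F p (x p j))) :
    perf T₁ h₁ F - perf T₂ h₂ F ≤ worstCaseGap T₁ T₂ h₁ h₂ F x c := by
  refine le_trans ?_ ((isGreatest_worstCaseGap hN hc).2 ⟨_, hx.1, rfl⟩)
  refine le_of_le_of_eq ?_ (linearized_sub_linearized hx.1).symm
  have h2 := hx.2
  set y : ∀ p, Fin (N p) → ℝ :=
    fun p j => influence T₁ h₁ F p (x p j) - influence T₂ h₂ F p (x p j) with hy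
  change -g < ∑ p, ∑ j, √A / N p * y p j at hg
  change _ ≤ _ + ∑ p, ∑ j, tilt (lam * √A / N p) (y p) j * y p j
  simp_rw [sum_tilt_mul]
  have e : ∑ p, ∑ j, √A / N p * y p j = √A * ∑ p, sampleMean (y p) := by
    rw [Finset.mul_sum]
    refine Finset.sum_congr rfl fun p _ => ?_
    rw [← Finset.mul_sum, sampleMean]
    ring
  rw [e] at hg
  rw [Finset.sum_add_distrib]
  have hs : 0 < √A := Real.sqrt_pos.2 hA
  have : 0 < √A * (∑ p, sampleMean (y p) + ∑ p, lam * √A / N p * sampleVar (y p)) := by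
    rw [mul_add]; linarith
  have := (pos_iff_pos_of_mul_pos this).1 hs
  linarith

end Attainment

/-! ### Variances of the differences and assembly of the coverage bound. -/

/-- The Bochner integral of a non-integrable function is 0, so a positive diagonal entry of the
covariance matrix forces the square to be integrable. -/
lemma memLp_two_of_posDef_cov {E : Type*} [MeasurableSpace E] {μ : Measure E}
    {k : ℕ} {f : Fin k → E → ℝ}
    (hf : ∀ i, Integrable (f i) μ) (h0 : ∀ i, ∫ x, f i x ∂μ = 0)
    (hcov : (Matrix.of fun i j : Fin k => cov[f i, f j; μ]).PosDef) (i : Fin k) :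
    MemLp (f i) 2 μ := by
  have h1 := hcov.diag_pos (i := i)
  simp only [Matrix.of_apply, covariance, h0, sub_zero] at h1
  rw [memLp_two_iff_integrable_sq (hf i).1]
  have := Integrable.of_integral_ne_zero h1.ne'
  exact this.congr (ae_of_all _ fun x => (sq (f i x)).symm)

/-- The integral is the covariance quadratic form at `e_i - e_l`. -/
lemma integral_sub_sq_pos_of_posDef_cov {E : Type*} [MeasurableSpace E] {μ : Measure E}
    {k : ℕ} {f : Fin k → E → ℝ}
    (hf : ∀ i, Integrable (f i) μ) (h0 : ∀ i, ∫ x, f i x ∂μ = 0)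
    (hcov : (Matrix.of fun i j : Fin k => cov[f i, f j; μ]).PosDef) {i l : Fin k} (hil : l ≠ i) :
    0 < ∫ x, (f i x - f l x) ^ 2 ∂μ := by
  have hL2 := memLp_two_of_posDef_cov hf h0 hcov
  have hint : ∀ a b, Integrable (fun x => f a x * f b x) μ := fun a b =>
    (hL2 a).integrable_mul (hL2 b)
  have hx : (Pi.single i 1 - Pi.single l 1 : Fin k → ℝ) ≠ 0 := by
    intro h
    have := congrFun h i
    simp [Pi.single_eq_of_ne hil.symm] at this
  have h1 := hcov.dotProduct_mulVec_pos hx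
  simp only [star_trivial, Matrix.mulVec_sub, sub_dotProduct, dotProduct_sub,
    Matrix.mulVec_single_one, single_one_dotProduct, Matrix.col_apply, Matrix.of_apply,
    covariance, h0, sub_zero] at h1
  have e : ∫ x, (f i x - f l x) ^ 2 ∂μ = ∫ x, f i x * f i x ∂μ - ∫ x, f i x * f l x ∂μ -
      (∫ x, f l x * f i x ∂μ - ∫ x, f l x * f l x ∂μ) := by
    rw [← integral_sub (hint _ _) (hint _ _), ← integral_sub (hint _ _) (hint _ _),
      ← integral_sub (f := fun x => f i x * f i x - f i x * f l x)
        (g := fun x => f l x * f i x - f l x * f l x)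
        ((hint _ _).sub (hint _ _)) ((hint _ _).sub (hint _ _))]
    refine integral_congr_ae (ae_of_all _ fun x => ?_)
    ring
  rw [e]
  linarith

lemma tendsto_sampleSize {m : ℕ} {N : ℕ → Fin m → ℕ}
    (hN : Tendsto (fun r => avgSize (N r)) atTop atTop) {p : Fin m} {b : ℝ} (hb : 0 < b)
    (hNb : Tendsto (fun r => (N r p : ℝ) / avgSize (N r)) atTop (𝓝 b)) :
    Tendsto (fun r => N r p) atTop atTop := by
  rw [← tendsto_natCast_atTop_iff (R := ℝ)]
  refine (hNb.pos_mul_atTop hb hN).congr' ?_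
  filter_upwards [hN.eventually_gt_atTop 0] with r hr
  field_simp

lemma coverage {m q : ℕ} {Ξ : Fin m → Type*} [∀ p, MeasurableSpace (Ξ p)]
    [∀ p, MeasurableSingletonClass (Ξ p)]
    {F : ∀ p, Measure (Ξ p)}
    {T : Fin (q + 2) → Fin m → ℕ} {h : ∀ i, (∀ p, Fin (T i p) → Ξ p) → ℝ}
    (hIF : ∀ i p, Integrable (influence (T i) (h i) F p) (F p))
    (hIF0 : ∀ i p, ∫ x, influence (T i) (h i) F p x ∂F p = 0)
    (h_cov : ∀ p, (Matrix.of fun i j : Fin (q + 2) =>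
      cov[influence (T i) (h i) F p, influence (T j) (h j) F p; F p]).PosDef)
    {Ω : Type*} [MeasurableSpace Ω] {P : Measure Ω} [IsProbabilityMeasure P]
    {X : ∀ p : Fin m, ℕ → Ω → Ξ p} (hX_law : ∀ p j, HasLaw (X p j) (F p) P)
    (hX_indep : iIndepFun (fun a : (_ : Fin m) × ℕ => X a.1 a.2) P)
    {N : ℕ → Fin m → ℕ} (hN : Tendsto (fun r => avgSize (N r)) atTop atTop)
    {β : Fin m → ℝ} (hβ : ∀ p, 0 < β p)
    (hNβ : ∀ p, Tendsto (fun r => (N r p : ℝ) / avgSize (N r)) atTop (𝓝 (β p)))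
    {u v : ℝ} (hu : 0 < u) (hu1 : u < 1) (hv : v < u) (i : Fin (q + 2)) :
    ∀ᶠ r in atTop, v ≤ P.real {ω | ∀ l, l ≠ i →
      perf (T i) (h i) F - perf (T l) (h l) F ≤
        worstCaseGap (T i) (T l) (h i) (h l) F (N := N r) (fun p j => X p j ω)
          (chiSquareQuantile (q + 1) u)} := by
  -- With no sources the average size would be 0; a source is needed for a positive limiting
  -- variance.
  have hm : 0 < m := by
    rcases Nat.eq_zero_or_pos m with rfl | hm
    · obtain ⟨r, hr⟩ := (hN.eventually_gt_atTop 0).exists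
      simp [avgSize] at hr
    · exact hm
  set c := chiSquareQuantile (q + 1) u with hc
  have hc0 : 0 < c := chiSquareQuantile_pos q hu hu1
  set D : Fin (q + 1) → ∀ p, Ξ p → ℝ := fun l p x =>
    influence (T i) (h i) F p x - influence (T (i.succAbove l)) (h (i.succAbove l)) F p x with hD
  have hDL2 : ∀ l p, MemLp (D l p) 2 (F p) := fun l p =>
    (memLp_two_of_posDef_cov (fun i => hIF i p) (fun i => hIF0 i p) (h_cov p) i).sub
      (memLp_two_of_posDef_cov (fun i => hIF i p) (fun i => hIF0 i p) (h_cov p) _)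
  have hD0 : ∀ l p, ∫ x, D l p x ∂F p = 0 := by
    intro l p
    rw [integral_sub (hIF _ _) (hIF _ _), hIF0, hIF0, sub_zero]
  have hDpos : ∀ l p, 0 < ∫ x, D l p x ^ 2 ∂F p := fun l p =>
    integral_sub_sq_pos_of_posDef_cov (fun i => hIF i p) (fun i => hIF0 i p) (h_cov p)
      (Fin.succAbove_ne i l)
  have hDm : ∀ l p j, AEMeasurable (D l p) (P.map (X p j)) := fun l p j => by
    rw [(hX_law p j).map_eq]; exact (hDL2 l p).1.aemeasurable
  have hXm : ∀ p j, AEMeasurable (X p j) P := fun p j => (hX_law p j).aemeasurable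
  have hNtop : ∀ p, Tendsto (fun r => N r p) atTop atTop := fun p =>
    tendsto_sampleSize hN (hβ p) (hNβ p)
  set γ : Fin m → ℝ := fun p => (β p)⁻¹ with hγd
  have hγ0 : ∀ p, 0 < γ p := fun p => inv_pos.2 (hβ p)
  have hγ : ∀ p, Tendsto (fun r => avgSize (N r) / N r p) atTop (𝓝 (γ p)) := fun p =>
    ((hNβ p).inv₀ (hβ p).ne').congr fun r => inv_div _ _
  -- the vectors of differences
  let V : ∀ p, Ξ p → EuclideanSpace ℝ (Fin (q + 1)) := fun p x => WithLp.toLp 2 fun l => D l p x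
  let Y : Fin m → ℕ → Ω → EuclideanSpace ℝ (Fin (q + 1)) := fun p j ω => V p (X p j ω)
  have hVm : ∀ p j, AEMeasurable (V p) (P.map (X p j)) := fun p j =>
    (by fun_prop : Measurable (WithLp.toLp 2 : (Fin (q + 1) → ℝ) → _)).comp_aemeasurable
      (aemeasurable_pi_lambda _ fun l => hDm l p j)
  have hY : ∀ p j, AEMeasurable (Y p j) P := fun p j => (hVm p j).comp_aemeasurable (hXm p j)
  have hmapcomp : ∀ {G : Type} [MeasurableSpace G] (p : Fin m) (j : ℕ) (f : Ξ p → G),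
      (∀ j, AEMeasurable f (P.map (X p j))) →
      P.map (fun ω => f (X p j ω)) = (F p).map f := by
    intro G _ p j f hf
    have := AEMeasurable.map_map_of_aemeasurable (hf j) (hXm p j)
    rw [(hX_law p j).map_eq] at this
    exact this.symm
  have hYid : ∀ p j, P.map (Y p j) = P.map (Y p 0) := fun p j =>
    (hmapcomp p j (V p) (hVm p)).trans (hmapcomp p 0 (V p) (hVm p)).symm
  have hYind : iIndepFun (fun a : (_ : Fin m) × ℕ => Y a.1 a.2) P :=
    hX_indep.comp₀ (fun a => V a.1) (fun a => hXm a.1 a.2) (fun a => hVm a.1 a.2)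
  have hDX : ∀ l p j, MemLp (fun ω => D l p (X p j ω)) 2 P := fun l p j =>
    MemLp.comp_of_map (g := D l p) (by rw [(hX_law p j).map_eq]; exact hDL2 l p) (hXm p j)
  have hint1 : ∀ l p, ∫ ω, D l p (X p 0 ω) ∂P = 0 := by
    intro l p
    rw [← integral_map (hXm p 0) (hDm l p 0).aestronglyMeasurable, (hX_law p 0).map_eq, hD0]
  have hint2 : ∀ l p, ∫ ω, D l p (X p 0 ω) ^ 2 ∂P = ∫ x, D l p x ^ 2 ∂F p := by
    intro l p
    rw [← (hX_law p 0).map_eq]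
    exact (integral_map (f := fun x => D l p x ^ 2) (hXm p 0)
      ((hDm l p 0).pow_const 2).aestronglyMeasurable).symm
  have hσpos : ∀ l, 0 < ∑ p, γ p * ∫ ω, D l p (X p 0 ω) ^ 2 ∂P := by
    intro l
    refine Finset.sum_pos (fun p _ => mul_pos (hγ0 p) ?_) ⟨⟨0, hm⟩, Finset.mem_univ _⟩
    rw [hint2]; exact hDpos l p
  have hdiag : ∀ l, limitCov P (fun p => Y p 0) γ l l =
      ∑ p, γ p * ∫ ω, D l p (X p 0 ω) ^ 2 ∂P := by
    intro l
    simp only [limitCov, Matrix.of_apply, sq]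
    rfl
  -- The slack `u - v` is split: `u - v'` pays for shrinking the ball, `v' - v` for inadmissible
  -- tilts.
  obtain ⟨v', hv1, hv2⟩ := exists_between hv
  obtain ⟨d, hd, hdlt⟩ := exists_lt_chiSquare_Iio q hu hu1 hv2
  rw [← hc] at hdlt
  have hs : 0 < (1 - d) * √c := mul_pos (by linarith [hd.2]) (Real.sqrt_pos.2 hc0)
  have ha : ∀ p, Tendsto (fun r => (N r p : ℝ) * (√(avgSize (N r)) / N r p) ^ 2) atTop
      (𝓝 (γ p)) := by
    intro p
    refine (hγ p).congr' ?_
    filter_upwards [hN.eventually_gt_atTop 0, (hNtop p).eventually_gt_atTop 0] with r hr hr'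
    have : (0 : ℝ) < N r p := by exact_mod_cast hr'
    rw [div_pow, Real.sq_sqrt hr.le]
    field_simp
  have hclt := chiSquare_le_liminf_orthant hY hYid hYind (fun p l => hDX l p 0)
    (fun p l => hint1 l p) hNtop ha (fun p => (hγ0 p).le)
    (fun l => by rw [hdiag]; exact hσpos l) hs
  have hev1 := eventually_lt_of_lt_liminf (lt_of_lt_of_le hdlt hclt)
  set σ : Fin (q + 1) → ℝ := fun l => √(∑ p, γ p * ∫ ω, D l p (X p 0 ω) ^ 2 ∂P) with hσ
  set C : Fin (q + 1) → ℕ → Set Ω := fun l r =>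
    {ω | (fun p (j : Fin (N r p)) => D l p (X p j ω)) ∈
      tiltSet (N r) (avgSize (N r)) ((1 - d / 2) * √c / σ l) c ((1 - d) * √c * σ l)} with hCd
  have hC : Tendsto (fun r => ∑ l, P (C l r)ᶜ) atTop (𝓝 0) := by
    rw [show (0 : ENNReal) = ∑ _l : Fin (q + 1), 0 by simp]
    refine tendsto_finsetSum _ fun l _ => ?_
    exact tendsto_measure_compl_tiltSet (Y := fun p j ω => D l p (X p j ω))
      (fun p j => (hDm l p j).comp_aemeasurable (hXm p j))
      (fun p j => (hmapcomp p j (D l p) (hDm l p)).trans (hmapcomp p 0 (D l p) (hDm l p)).symm)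
      (hX_indep.comp₀ (fun a => D l a.1) (fun a => hXm a.1 a.2) (fun a => hDm l a.1 a.2))
      (fun p => hDX l p 0) (fun p => hint1 l p) hNtop hN hγ hc0 hd (hσpos l)
  have hev2 := hC.eventually (gt_mem_nhds (ENNReal.ofReal_pos.2 (sub_pos.2 hv1)))
  filter_upwards [hev1, hev2, hN.eventually_gt_atTop 0,
    eventually_all.2 fun p => (hNtop p).eventually_gt_atTop 0] with r h1 h2 hA hNr
  set G := {ω | ∀ l, l ≠ i → perf (T i) (h i) F - perf (T l) (h l) F ≤
    worstCaseGap (T i) (T l) (h i) (h l) F (N := N r) (fun p j => X p j ω) c} with hG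
  have hsub : {ω | ∀ l, -((1 - d) * √c * √(limitCov P (fun p => Y p 0) γ l l)) <
      ∑ p, ∑ j : Fin (N r p), √(avgSize (N r)) / N r p * Y p j ω l} ⊆ G ∪ ⋃ l, (C l r)ᶜ := by
    intro ω hω
    by_cases hωC : ∃ l, ω ∉ C l r
    · exact Or.inr (Set.mem_iUnion.2 hωC)
    · push Not at hωC
      refine Or.inl fun l hl => ?_
      obtain ⟨l', rfl⟩ := Fin.exists_succAbove_eq hl
      refine perf_sub_le_worstCaseGap hNr hc0.le hA (hωC l') ?_
      have := hω l'
      rw [hdiag] at this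
      exact this
  have h3 : ENNReal.ofReal v' ≤ ENNReal.ofReal (P.real G + (v' - v)) := by
    rw [ENNReal.ofReal_add measureReal_nonneg (sub_pos.2 hv1).le, ofReal_measureReal]
    refine h1.le.trans ((measure_mono hsub).trans ((measure_union_le _ _).trans ?_))
    gcongr
    exact (measure_iUnion_fintype_le _ _).trans h2.le
  have h4 := (ENNReal.ofReal_le_ofReal_iff
    (add_nonneg measureReal_nonneg (sub_pos.2 hv1).le)).1 h3
  linarith

end InputUncertainty

theorem mainTheorem6 {m k : ℕ} {Ξ : Fin m → Type*} [∀ p, MeasurableSpace (Ξ p)]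
    [∀ p, MeasurableSingletonClass (Ξ p)]
    -- the true input model
    (F : ∀ p, Measure (Ξ p)) [∀ p, IsProbabilityMeasure (F p)]
    -- input lengths and output functions: measurable and square integrable
    (T : Fin k → Fin m → ℕ) (hT : ∀ i p, 0 < T i p)
    (h : ∀ i, (∀ p, Fin (T i p) → Ξ p) → ℝ)
    (h_meas : ∀ i, Measurable (h i))
    (h_sq : ∀ i, Integrable (fun z => |h i z| ^ 2) (InputUncertainty.inputLaw (T i) F))
    -- the expectations in the difference quotients defining the influence functions exist
    (h_pert : ∀ i p, ∀ᵐ x ∂(F p), ∀ᶠ ε in 𝓝[>] (0 : ℝ),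
      Integrable (h i)
        (InputUncertainty.inputLaw (T i) (InputUncertainty.perturb F p x ε)))
    -- the covariance matrices of the influence functions are positive definite
    (h_cov : ∀ p, (Matrix.of fun i j : Fin k =>
      cov[InputUncertainty.influence (T i) (h i) F p,
        InputUncertainty.influence (T j) (h j) F p; F p]).PosDef)
    -- i.i.d. data from each source, independent over the sources
    {Ω : Type*} [MeasurableSpace Ω] (P : Measure Ω) [IsProbabilityMeasure P]
    (X : ∀ p : Fin m, ℕ → Ω → Ξ p)
    (hX_law : ∀ p j, HasLaw (X p j) (F p) P)
    (hX_indep : iIndepFun (fun a : (_ : Fin m) × ℕ => X a.1 a.2) P)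
    -- the sample sizes along a sequence of data sets whose average size tends to infinity
    (N : ℕ → Fin m → ℕ) (hN : Tendsto (fun r => InputUncertainty.avgSize (N r)) atTop atTop)
    (β : Fin m → ℝ) (hβ : ∀ p, 0 < β p)
    (hNβ : ∀ p, Tendsto (fun r => (N r p : ℝ) / InputUncertainty.avgSize (N r)) atTop (𝓝 (β p)))
    (α : ℝ) (hα : α ∈ Set.Ioo (0 : ℝ) 1) (i : Fin k) :
    -- the programs eventually attain their optimal values
    (∀ᶠ r in atTop, ∀ ω, ∀ l, l ≠ i →
      IsGreatest
        (InputUncertainty.gapValues (T i) (T l) (h i) (h l) F (N := N r) (fun p j => X p j ω)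
          (InputUncertainty.chiSquareQuantile (k - 1) (1 - α)))
        (InputUncertainty.worstCaseGap (T i) (T l) (h i) (h l) F (N := N r) (fun p j => X p j ω)
          (InputUncertainty.chiSquareQuantile (k - 1) (1 - α)))) ∧
    1 - α ≤ liminf (fun r => P.real {ω | ∀ l, l ≠ i →
      InputUncertainty.perf (T i) (h i) F - InputUncertainty.perf (T l) (h l) F ≤
        InputUncertainty.worstCaseGap (T i) (T l) (h i) (h l) F (N := N r) (fun p j => X p j ω)
          (InputUncertainty.chiSquareQuantile (k - 1) (1 - α))}) atTop := by
  have hα1 : 0 < 1 - α := by linarith [hα.2]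
  have hint : ∀ i, Integrable (h i) (InputUncertainty.inputLaw (T i) F) := by
    intro i
    have : IsProbabilityMeasure (InputUncertainty.inputLaw (T i) F) := by
      unfold InputUncertainty.inputLaw; infer_instance
    have h2 : MemLp (h i) 2 (InputUncertainty.inputLaw (T i) F) :=
      (memLp_two_iff_integrable_sq (h_meas i).aestronglyMeasurable).2
        (by simpa only [sq_abs] using h_sq i)
    exact h2.integrable one_le_two
  have hIF := fun i p => InputUncertainty.integrable_influence (h_meas i) (hint i) (h_pert i p)
  refine ⟨?_, ?_⟩
  · filter_upwards [eventually_all.2 fun p =>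
      (InputUncertainty.tendsto_sampleSize hN (hβ p) (hNβ p)).eventually_gt_atTop 0] with r hr ω l _
    exact InputUncertainty.isGreatest_worstCaseGap hr
      (InputUncertainty.chiSquareQuantile_nonneg _ hα1)
  -- The real-valued liminf is meaningful because probabilities are at most 1.
  · have hcob : IsCoboundedUnder (· ≥ ·) atTop (fun r => P.real {ω | ∀ l, l ≠ i →
        InputUncertainty.perf (T i) (h i) F - InputUncertainty.perf (T l) (h l) F ≤
          InputUncertainty.worstCaseGap (T i) (T l) (h i) (h l) F (N := N r) (fun p j => X p j ω)
            (InputUncertainty.chiSquareQuantile (k - 1) (1 - α))}) :=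
      (isBoundedUnder_of ⟨1, fun r => measureReal_le_one⟩).isCoboundedUnder_ge
    refine le_of_forall_lt fun v hv => ?_
    obtain ⟨v', hv1, hv2⟩ := exists_between hv
    refine hv1.trans_le (le_liminf_of_le hcob ?_)
    rcases k with _ | _ | q
    · exact i.elim0
    -- With a single system there is no competitor, so the event is the whole space.
    · refine Eventually.of_forall fun r => ?_
      have : ∀ l : Fin (0 + 1), l = i := fun l => Subsingleton.elim (α := Fin 1) _ _
      simp only [this, ne_eq, not_true_eq_false, false_imp_iff, implies_true, Set.ofPred_true,
        measureReal_def, measure_univ]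
      simp only [ENNReal.toReal_one]
      linarith [hα.1]
    · exact InputUncertainty.coverage (fun i p => (hIF i p).1) (fun i p => (hIF i p).2) h_cov
        hX_law hX_indep hN hβ hNβ hα1 (by linarith [hα.1]) hv2 i
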